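/- Let $D\subset\mathbb C$ be open, let $\Omega\subset\mathbb C$ be a domain with $D\subset\Omega$, and let $f:D\to D$ be holomorphic, with iterates $f^n$, $n\in\mathbb N=\{1,2,\dots\}$. For open $U\subset\mathbb C$, let $H(U)$ be the space of holomorphic functions on $U$ with the topology of locally uniform convergence. Let $\mathbb C_\infty=\mathbb C\cup\{\infty\}$ carry the chordal metric, and let $\partial_\infty\Omega$ be the boundary of $\Omega$ in $\mathbb C_\infty$. A hole of a set $M\subset\mathbb C$ is a connected component of $\mathbb C_\infty\setminus M$ that does not contain $\infty$. Let $\mathcal K_0(D)$ and $\mathcal U_0(D)$ denote the families of all nonempty subsets of $D$ without holes that are compact, respectively open. Let $\mathcal U_0(D,\Omega,f)$ be the family of all $U\in\mathcal U_0(D)$ such that every iterate $f^n$ is injective on $U$ and the chordal distance $\operatorname{dist}(f^n(\cdot),\partial_\infty\Omega)$ tends to $0$ locally uniformly on $U$ as $n\to\infty$. A sequence $(M_n)$ of subsets of $D$ is called $\mathcal K_0(D)$-exhausting if for every $L\in\mathcal K_0(D)$ there is an $N$ with $L\subset M_N^\circ$. For $U\in\mathcal U_0(D)$, a function $g\in H(\Omega)$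 is called $H(U)$-universal for $C_f$ if $\{g\circ f^n|_U:n\in\mathbb N\}$ is dense in $H(U)$. A subset of $H(\Omega)$ is called comeager if it contains a dense $G_\delta$-set. Suppose that there exists a $\mathcal K_0(D)$-exhausting sequence of sets in $\mathcal U_0(D,\Omega,f)$. Then the set of all functions $g\in H(\Omega)$ which are $H(U)$-universal for $C_f$ for all $U\in\mathcal U_0(D)$ simultaneously is a comeager set in $H(\Omega)$. -/

import Mathlib

open Set Filter Topology

namespace CompUniv

/-- The image of `M ⊆ ℂ` in the extended complex plane `ℂ_∞ = OnePoint ℂ`. -/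
def toSphere (M : Set ℂ) : Set (OnePoint ℂ) := OnePoint.some '' M

/-- A hole of `M ⊆ ℂ` is a connected component of `ℂ_∞ \ M` that does not contain `∞`. -/
def IsHole (M : Set ℂ) (H : Set (OnePoint ℂ)) : Prop :=
  (∃ x ∈ (toSphere M)ᶜ, H = connectedComponentIn (toSphere M)ᶜ x) ∧ OnePoint.infty ∉ H

def HasNoHoles (M : Set ℂ) : Prop := ∀ H : Set (OnePoint ℂ), ¬ IsHole M H

/-- `𝒦₀(M)`: the nonempty compact subsets of `M` without holes. -/
def KZero (M : Set ℂ) : Set (Set ℂ) :=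
  {K | K ⊆ M ∧ IsCompact K ∧ K.Nonempty ∧ HasNoHoles K}

/-- `𝒰₀(M)`: the nonempty open subsets of `M` without holes. -/
def UZero (M : Set ℂ) : Set (Set ℂ) :=
  {U | U ⊆ M ∧ IsOpen U ∧ U.Nonempty ∧ HasNoHoles U}

/-- The chordal distance on `ℂ_∞`. -/
noncomputable def chordalDist : OnePoint ℂ → OnePoint ℂ → ℝ
  | OnePoint.some z, OnePoint.some w =>
      2 * ‖z - w‖ / (Real.sqrt (1 + ‖z‖ ^ 2) * Real.sqrt (1 + ‖w‖ ^ 2))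
  | OnePoint.some z, OnePoint.infty => 2 / Real.sqrt (1 + ‖z‖ ^ 2)
  | OnePoint.infty, OnePoint.some w => 2 / Real.sqrt (1 + ‖w‖ ^ 2)
  | OnePoint.infty, OnePoint.infty => 0

/-- The chordal distance of a point to a (nonempty) set. -/
noncomputable def chordalInfDist (z : OnePoint ℂ) (A : Set (OnePoint ℂ)) : ℝ :=
  sInf (chordalDist z '' A)

/-- The boundary `∂_∞ M` of `M ⊆ ℂ` taken in `ℂ_∞`. -/
def sphereBoundary (M : Set ℂ) : Set (OnePoint ℂ) := frontier (toSphere M)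

/-- `𝒰₀(D, Ω, f)`: the `U ∈ 𝒰₀(D)` on which the chordal distance of `f^n` to `∂_∞ Ω` tends
to `0` locally uniformly and on which every iterate `f^n` is injective. -/
def UZeroDyn (D Ω : Set ℂ) (f : ℂ → ℂ) : Set (Set ℂ) :=
  {U | U ∈ UZero D ∧
    TendstoLocallyUniformlyOn
      (fun (n : ℕ) (z : ℂ) => chordalInfDist (OnePoint.some (f^[n] z)) (sphereBoundary Ω))
      (fun _ => 0) atTop U ∧
    ∀ n : ℕ, InjOn f^[n] U}

/-- `(M_n)` is a `𝒦₀(V)`-exhausting sequence of subsets of `V`. -/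
def IsKZeroExhausting (V : Set ℂ) (M : ℕ → Set ℂ) : Prop :=
  (∀ n, M n ⊆ V) ∧ ∀ L ∈ KZero V, ∃ N, L ⊆ interior (M N)

/-- `H(U)` for open `U ⊆ ℂ`: the holomorphic functions on `U`, as a subset of the space
`C(U, ℂ)`, whose (compact-open) topology is that of locally uniform convergence. -/
def Hol (U : Set ℂ) : Set C(U, ℂ) :=
  {g | ∃ G : ℂ → ℂ, DifferentiableOn ℂ G U ∧ ∀ z : U, g z = G z}

/-- The set `{g ∘ f^n|_M : n ≥ 1}` in `C(M, ℂ)`, for a function `g` on `Ω`. -/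
def compOrbit {Ω : Set ℂ} (f : ℂ → ℂ) (M : Set ℂ) (g : C(Ω, ℂ)) : Set C(M, ℂ) :=
  {h | ∃ n : ℕ, 1 ≤ n ∧ ∀ z : M, ∃ hz : f^[n] z ∈ Ω, h z = g ⟨f^[n] z, hz⟩}

/-- `g ∈ H(Ω)` is `ℱ`-universal for `C_f`, where `ℱ ⊆ C(M, ℂ)`. -/
def IsUniversal {Ω : Set ℂ} (f : ℂ → ℂ) (M : Set ℂ) (F : Set C(M, ℂ)) (g : Hol Ω) : Prop :=
  F ⊆ closure (compOrbit f M g.1)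

/-- A set is comeager if it contains a dense `G_δ`-set. -/
def IsComeager {X : Type*} [TopologicalSpace X] (S : Set X) : Prop :=
  ∃ T : Set X, T ⊆ S ∧ IsGδ T ∧ Dense T

end CompUniv

open CompUniv

namespace CompUniv

/-- Twice the Wirtinger derivative `∂F/∂z̄`. -/
noncomputable def dbar (F : ℂ → ℂ) (w : ℂ) : ℂ := fderiv ℝ F w 1 + Complex.I * fderiv ℝ F w Complex.I

section CauchyPompeiu

open MeasureTheory Complex

lemma fderiv_real_apply (F : ℂ → ℂ) (w : ℂ) (a b : ℝ) :
    fderiv ℝ F w (a + b * I) = a * fderiv ℝ F w 1 + b * fderiv ℝ F w I := by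
  have : (a + b * I : ℂ) = a • (1 : ℂ) + b • I := by simp
  rw [this, map_add, map_smul, map_smul]; simp

lemma dbar_div_polar (F : ℂ → ℂ) (r θ : ℝ) (hr : 0 < r) :
    r • (dbar F (r * exp (θ * I)) / (r * exp (θ * I))) =
      fderiv ℝ F (r * exp (θ * I)) (exp (θ * I)) +
        I * fderiv ℝ F (r * exp (θ * I)) (I * exp (θ * I)) := by
  set w := (r * exp (θ * I) : ℂ)
  have he : exp (θ * I) = (Real.cos θ : ℝ) + (Real.sin θ : ℝ) * I := by
    rw [exp_mul_I]; simp
  have hie : I * exp (θ * I) = ((-Real.sin θ : ℝ) : ℂ) + (Real.cos θ : ℝ) * I := by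
    rw [he]; push_cast; linear_combination (Complex.sin θ) * I_sq
  have h1 : r • (dbar F w / w) = exp (-(θ * I)) * dbar F w := by
    have : (r : ℂ) ≠ 0 := by exact_mod_cast hr.ne'
    simp only [w, real_smul, Complex.exp_neg]
    field_simp
  have h2 : exp (-(θ * I)) = (Real.cos θ : ℝ) - (Real.sin θ : ℝ) * I := by
    rw [← neg_mul, exp_mul_I]; simp [sub_eq_add_neg]
  rw [h1, hie, h2]
  conv_rhs => enter [1]; rw [he]
  rw [fderiv_real_apply, fderiv_real_apply, dbar]
  push_cast
  linear_combination (-Complex.sin θ * fderiv ℝ F w I) * I_sq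

lemma integrableOn_polar_of_continuous {A : ℝ × ℝ → ℂ} (hA : Continuous A) {R : ℝ}
    (h0 : ∀ p : ℝ × ℝ, R < p.1 → A p = 0) : IntegrableOn A (Ioi 0 ×ˢ Ioo (-Real.pi) Real.pi) := by
  have h1 : IntegrableOn A (Icc 0 R ×ˢ Icc (-Real.pi) Real.pi) :=
    hA.continuousOn.integrableOn_compact (isCompact_Icc.prod isCompact_Icc)
  refine h1.of_forall_sdiff_eq_zero (measurableSet_Ioi.prod measurableSet_Ioo) ?_
  rintro ⟨r, θ⟩ ⟨⟨hr, hθ⟩, hn⟩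
  apply h0
  by_contra hR
  exact hn ⟨⟨le_of_lt hr, not_lt.1 hR⟩, Ioo_subset_Icc_self hθ⟩

lemma hasDerivAt_polar_radius {u : ℂ → ℂ} (hu : ContDiff ℝ 1 u) (r θ : ℝ) :
    HasDerivAt (fun r : ℝ => u (r * exp (θ * I)))
      (fderiv ℝ u (r * exp (θ * I)) (exp (θ * I))) r := by
  have h1 := (hu.differentiable one_ne_zero (r * exp (θ * I))).hasFDerivAt
  have h2 : HasDerivAt (fun r : ℝ => (r * exp (θ * I) : ℂ)) (1 * exp (θ * I)) r :=
    (ofRealCLM.hasDerivAt (x := r)).mul_const _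
  have h3 := h1.comp_hasDerivAt r h2
  rw [one_mul] at h3
  exact h3

lemma hasDerivAt_polar_angle {u : ℂ → ℂ} (hu : ContDiff ℝ 1 u) (r θ : ℝ) :
    HasDerivAt (fun θ : ℝ => u (r * exp (θ * I)))
      (r * fderiv ℝ u (r * exp (θ * I)) (I * exp (θ * I))) θ := by
  have h1 := (hu.differentiable one_ne_zero (r * exp (θ * I))).hasFDerivAt
  have h2 : HasDerivAt (fun θ : ℝ => (r * exp (θ * I) : ℂ))
      (r * (exp (θ * I) * (1 * I))) θ :=
    (((ofRealCLM.hasDerivAt (x := θ)).mul_const I).cexp).const_mul _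
  have h3 := h1.comp_hasDerivAt θ h2
  have : (r * (exp (θ * I) * (1 * I)) : ℂ) = r • (I * exp (θ * I)) := by
    rw [real_smul]; ring
  rw [this, map_smul, real_smul] at h3
  exact h3

theorem cauchy_pompeiu_zero {u : ℂ → ℂ} (hu : ContDiff ℝ 1 u) (hc : HasCompactSupport u) :
    ∫ w, dbar u w / w = -(2 * Real.pi) * u 0 := by
  obtain ⟨R, hR⟩ := hc.isCompact.isBounded.subset_closedBall 0
  have hR0 : ∀ w : ℂ, |R| < ‖w‖ → fderiv ℝ u w = 0 := by
    intro w hw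
    by_contra h
    have := hR (support_fderiv_subset ℝ (Function.mem_support.2 h))
    rw [mem_closedBall_zero_iff] at this
    linarith [le_abs_self R]
  have hR1 : ∀ w : ℂ, |R| < ‖w‖ → u w = 0 := by
    intro w hw
    by_contra h
    have := hR (subset_tsupport _ (Function.mem_support.2 h))
    rw [mem_closedBall_zero_iff] at this
    linarith [le_abs_self R]
  have hnorm : ∀ p : ℝ × ℝ, |R| < p.1 → |R| < ‖(p.1 * exp (p.2 * I) : ℂ)‖ := by
    intro p hp
    rw [norm_mul, norm_exp_ofReal_mul_I, mul_one, norm_real]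
    exact hp.trans_le (le_abs_self _)
  have hfc := hu.continuous_fderiv one_ne_zero
  set A : ℝ × ℝ → ℂ := fun p => fderiv ℝ u (p.1 * exp (p.2 * I)) (exp (p.2 * I)) with hA
  set B : ℝ × ℝ → ℂ := fun p => fderiv ℝ u (p.1 * exp (p.2 * I)) (I * exp (p.2 * I)) with hB
  have hAc : Continuous A := by
    have : Continuous fun p : ℝ × ℝ => fderiv ℝ u (p.1 * exp (p.2 * I)) := hfc.comp (by fun_prop)
    exact this.clm_apply (by fun_prop)
  have hBc : Continuous B := by
    have : Continuous fun p : ℝ × ℝ => fderiv ℝ u (p.1 * exp (p.2 * I)) := hfc.comp (by fun_prop)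
    exact this.clm_apply (by fun_prop)
  have hAi := integrableOn_polar_of_continuous hAc (R := |R|)
    (fun p hp => by simp [hA, hR0 _ (hnorm p hp)])
  have hBi := integrableOn_polar_of_continuous hBc (R := |R|)
    (fun p hp => by simp [hB, hR0 _ (hnorm p hp)])
  rw [← Complex.integral_comp_polarCoord_symm]
  have e1 : ∫ p in polarCoord.target, p.1 • (dbar u (Complex.polarCoord.symm p) /
      Complex.polarCoord.symm p) = ∫ p in Ioi (0:ℝ) ×ˢ Ioo (-Real.pi) Real.pi, (A p + I * B p) := by
    refine setIntegral_congr_fun (measurableSet_Ioi.prod measurableSet_Ioo) ?_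
    rintro ⟨r, θ⟩ ⟨hr, -⟩
    have hs : Complex.polarCoord.symm (r, θ) = r * exp (θ * I) := by
      rw [Complex.polarCoord_symm_apply, exp_mul_I]; simp
    simp only [hs]
    exact dbar_div_polar u r θ hr
  rw [e1, integral_add hAi (hBi.const_mul I), integral_const_mul]
  have eA : ∫ p in Ioi (0:ℝ) ×ˢ Ioo (-Real.pi) Real.pi, A p = -(2 * Real.pi) * u 0 := by
    rw [Measure.volume_eq_prod] at hAi ⊢
    rw [setIntegral_prod _ hAi, integral_integral_swap (by
      rwa [Function.uncurry_def, Measure.prod_restrict])]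
    have : ∀ θ : ℝ, ∫ r in Ioi (0:ℝ), A (r, θ) = - u 0 := by
      intro θ
      have hi : IntegrableOn (fun r => A (r, θ)) (Ioi 0) := by
        have h1 : IntegrableOn (fun r => A (r, θ)) (Icc 0 |R|) :=
          (hAc.comp (by fun_prop : Continuous fun r : ℝ => (r, θ))).continuousOn.integrableOn_compact
            isCompact_Icc
        refine h1.of_forall_sdiff_eq_zero measurableSet_Ioi ?_
        rintro r ⟨hr, hn⟩
        have : |R| < r := by
          by_contra h
          exact hn ⟨le_of_lt hr, not_lt.1 h⟩
        simp [hA, hR0 _ (hnorm (r, θ) this)]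
      have ht : Tendsto (fun r : ℝ => u (r * exp (θ * I))) atTop (𝓝 0) := by
        refine tendsto_const_nhds.congr' ?_
        filter_upwards [eventually_gt_atTop |R|] with r hr
        exact (hR1 _ (hnorm (r, θ) hr)).symm
      rw [integral_Ioi_of_hasDerivAt_of_tendsto' (fun r _ => hasDerivAt_polar_radius hu r θ) hi ht]
      simp
    simp only [this]
    simp only [integral_const, MeasurableSet.univ, measureReal_restrict_apply, univ_inter,
      Real.volume_real_Ioo, real_smul]
    rw [max_eq_left (by linarith [Real.pi_pos])]
    push_cast; ring
  have eB : ∫ p in Ioi (0:ℝ) ×ˢ Ioo (-Real.pi) Real.pi, B p = 0 := by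
    rw [Measure.volume_eq_prod] at hBi ⊢
    rw [setIntegral_prod _ hBi]
    refine setIntegral_eq_zero_of_forall_eq_zero fun r hr => ?_
    have h1 : ∫ θ in (-Real.pi)..Real.pi, r * B (r, θ) = 0 := by
      rw [intervalIntegral.integral_eq_sub_of_hasDerivAt
        (fun θ _ => hasDerivAt_polar_angle hu r θ)]
      · simp [exp_neg]
      · exact (continuous_const.mul (hBc.comp
          (by fun_prop : Continuous fun θ : ℝ => (r, θ)))).intervalIntegrable _ _
    rw [intervalIntegral.integral_const_mul, intervalIntegral.integral_of_le
      (by linarith [Real.pi_pos]), ← integral_Ioc_eq_integral_Ioo.symm] at h1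
    have hr' : (r : ℂ) ≠ 0 := by exact_mod_cast (ne_of_gt hr)
    simpa [hr'] using h1
  rw [eA, eB]; simp

/-- The Cauchy-Pompeiu formula for compactly supported functions. -/
theorem cauchy_pompeiu {u : ℂ → ℂ} (hu : ContDiff ℝ 1 u) (hc : HasCompactSupport u) (z : ℂ) :
    ∫ w, dbar u w / (w - z) = -(2 * Real.pi) * u z := by
  have h := cauchy_pompeiu_zero (u := fun w => u (w + z)) (by fun_prop)
    (hc.comp_homeomorph (Homeomorph.addRight z))
  rw [zero_add] at h
  rw [← h, ← integral_add_right_eq_self _ z]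
  congr 1 with w
  simp [dbar, fderiv_comp_add_right]

lemma integral_fderiv_apply_eq_zero {u : ℂ → ℂ} (hu : ContDiff ℝ 1 u) (hc : HasCompactSupport u)
    (v : ℂ) : ∫ w, fderiv ℝ u w v = 0 := by
  have hi : Integrable (fun w => fderiv ℝ u w v) :=
    ((hu.continuous_fderiv one_ne_zero).clm_apply continuous_const).integrable_of_hasCompactSupport
      (hc.fderiv_apply ℝ v)
  have := integral_mul_fderiv_eq_neg_fderiv_mul_of_integrable (μ := volume) (𝕜 := ℂ)
    (f := fun _ => (1 : ℂ)) (g := u) (v := v)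
    (by simp) (by simpa using hi) (by simpa using hu.continuous.integrable_of_hasCompactSupport hc)
    (fun x _ => by fun_prop) (fun x _ => hu.differentiable one_ne_zero x)
  simpa using this

end CauchyPompeiu

section Poles

open Metric

/-- `(z - w)` becomes invertible on `X` in the uniform closure of the holomorphic functions
on `Ω`: the pole of `1 / (z - w)` can be pushed out of `Ω`. -/
def PoleRemovable (Ω X : Set ℂ) (w : ℂ) : Prop :=
  ∃ e : ℂ → ℂ, DifferentiableOn ℂ e Ω ∧ ∀ z ∈ X, ‖1 - (z - w) * e z‖ < 1

/-- Every point off `X` can be separated from `X` by functions that are holomorphic on `Ω`. -/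
def HolConvex (Ω X : Set ℂ) : Prop := ∀ w ∉ X, PoleRemovable Ω X w

variable {Ω X Y : Set ℂ} {w : ℂ}

lemma exists_norm_le_of_forall_norm_lt {α : Type*} [TopologicalSpace α] {X : Set α} {g : α → ℂ}
    (hX : IsCompact X) (hg : ContinuousOn g X) {c : ℝ} (hc : 0 < c) (h : ∀ z ∈ X, ‖g z‖ < c) :
    ∃ r, 0 ≤ r ∧ r < c ∧ ∀ z ∈ X, ‖g z‖ ≤ r := by
  rcases X.eq_empty_or_nonempty with rfl | hne
  · exact ⟨0, le_rfl, hc, by simp⟩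
  · obtain ⟨x, hx, hm⟩ := hX.exists_isMaxOn hne hg.norm
    exact ⟨‖g x‖, norm_nonneg _, h x hx, fun z hz => hm hz⟩

lemma PoleRemovable.mono (h : PoleRemovable Ω Y w) (hXY : X ⊆ Y) : PoleRemovable Ω X w :=
  let ⟨e, he, hl⟩ := h
  ⟨e, he, fun z hz => hl z (hXY hz)⟩

lemma PoleRemovable.notMem (h : PoleRemovable Ω X w) : w ∉ X := by
  obtain ⟨e, -, hl⟩ := h
  intro hw
  simpa using hl w hw

lemma PoleRemovable.approx (hX : IsCompact X) (hXΩ : X ⊆ Ω) (h : PoleRemovable Ω X w)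
    {ε : ℝ} (hε : 0 < ε) :
    ∃ e : ℂ → ℂ, DifferentiableOn ℂ e Ω ∧ ∀ z ∈ X, ‖e z - (z - w)⁻¹‖ < ε := by
  have hw := h.notMem
  obtain ⟨e, he, hl⟩ := h
  have hgc : DifferentiableOn ℂ (fun z => 1 - (z - w) * e z) Ω := by fun_prop
  obtain ⟨r, hr0, hr1, hr⟩ :=
    exists_norm_le_of_forall_norm_lt hX (hgc.continuousOn.mono hXΩ) one_pos hl
  have hic : ContinuousOn (fun z => (z - w)⁻¹) X :=
    ContinuousOn.inv₀ (by fun_prop) fun z hz => sub_ne_zero.2 (ne_of_mem_of_not_mem hz hw)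
  obtain ⟨C, hC⟩ := hX.exists_bound_of_continuousOn hic
  have ht : Tendsto (fun k : ℕ => r ^ k * (|C| + 1)) atTop (𝓝 (0 * (|C| + 1))) :=
    (tendsto_pow_atTop_nhds_zero_of_lt_one hr0 hr1).mul_const _
  rw [zero_mul] at ht
  obtain ⟨k, hk⟩ := (ht.eventually (gt_mem_nhds hε)).exists
  refine ⟨fun z => e z * ∑ j ∈ Finset.range k, (1 - (z - w) * e z) ^ j, by fun_prop, ?_⟩
  intro z hz
  have hz0 : z - w ≠ 0 := sub_ne_zero.2 (ne_of_mem_of_not_mem hz hw)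
  have key : e z * ∑ j ∈ Finset.range k, (1 - (z - w) * e z) ^ j - (z - w)⁻¹ =
      - ((1 - (z - w) * e z) ^ k * (z - w)⁻¹) := by
    have := mul_neg_geom_sum (1 - (z - w) * e z) k
    rw [sub_sub_cancel] at this
    generalize ∑ j ∈ Finset.range k, (1 - (z - w) * e z) ^ j = S at *
    generalize (1 - (z - w) * e z) ^ k = T at *
    field_simp
    linear_combination this
  rw [key, norm_neg, norm_mul, norm_pow]
  calc ‖1 - (z - w) * e z‖ ^ k * ‖(z - w)⁻¹‖ ≤ r ^ k * (|C| + 1) := by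
        gcongr
        · exact hr z hz
        · exact (hC z hz).trans ((le_abs_self C).trans (by linarith))
    _ < ε := hk

lemma PoleRemovable.of_approx (hX : IsCompact X) (hw : w ∉ X)
    (h : ∀ ε > 0, ∃ e : ℂ → ℂ, DifferentiableOn ℂ e Ω ∧ ∀ z ∈ X, ‖e z - (z - w)⁻¹‖ < ε) :
    PoleRemovable Ω X w := by
  obtain ⟨C, hC⟩ := hX.exists_bound_of_continuousOn
    (by fun_prop : ContinuousOn (fun z => z - w) X)
  obtain ⟨e, he, hl⟩ := h (|C| + 1)⁻¹ (by positivity)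
  refine ⟨e, he, fun z hz => ?_⟩
  have hz0 : z - w ≠ 0 := sub_ne_zero.2 (ne_of_mem_of_not_mem hz hw)
  have : 1 - (z - w) * e z = -((z - w) * (e z - (z - w)⁻¹)) := by field_simp; ring
  rw [this, norm_neg, norm_mul]
  have h1 : ‖z - w‖ < |C| + 1 := (hC z hz).trans_lt ((le_abs_self C).trans_lt (by linarith))
  calc ‖z - w‖ * ‖e z - (z - w)⁻¹‖ ≤ ‖z - w‖ * (|C| + 1)⁻¹ := by
        gcongr; exact (hl z hz).le
    _ < (|C| + 1) * (|C| + 1)⁻¹ := by gcongr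
    _ = 1 := mul_inv_cancel₀ (by positivity)

lemma PoleRemovable.of_notMem (hXΩ : X ⊆ Ω) (hw : w ∉ Ω) : PoleRemovable Ω X w := by
  refine ⟨fun z => (z - w)⁻¹, DifferentiableOn.inv (by fun_prop) fun z hz =>
    sub_ne_zero.2 (ne_of_mem_of_not_mem hz hw), fun z hz => ?_⟩
  rw [mul_inv_cancel₀ (sub_ne_zero.2 (ne_of_mem_of_not_mem (hXΩ hz) hw))]
  simp

lemma PoleRemovable.of_norm_lt (h : ∀ z ∈ X, ‖z‖ < ‖w‖) : PoleRemovable Ω X w := by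
  by_cases hw : w = 0
  · exact ⟨0, differentiableOn_const 0, fun z hz => absurd (h z hz) (by simp [hw])⟩
  refine ⟨fun _ => -w⁻¹, differentiableOn_const _, fun z hz => ?_⟩
  have : 1 - (z - w) * -w⁻¹ = z / w := by field_simp; ring
  rw [this, norm_div, div_lt_one (norm_pos_iff.2 hw)]
  exact h z hz

lemma PoleRemovable.of_separated (hΩ : IsOpen Ω) (hw : w ∈ Ω) {g : ℂ → ℂ}
    (hg : DifferentiableOn ℂ g Ω) (h : ∀ z ∈ X, ‖g z‖ < ‖g w‖) : PoleRemovable Ω X w := by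
  by_cases hw0 : g w = 0
  · exact ⟨0, differentiableOn_const 0, fun z hz => absurd (h z hz) (by simp [hw0])⟩
  refine ⟨fun z => -((g w)⁻¹ * dslope g w z), ?_, fun z hz => ?_⟩
  · have := (Complex.differentiableOn_dslope (hΩ.mem_nhds hw)).2 hg
    fun_prop
  · have h1 := sub_smul_dslope g w z
    rw [smul_eq_mul] at h1
    have : 1 - (z - w) * -((g w)⁻¹ * dslope g w z) = g z / g w := by
      field_simp
      linear_combination h1
    rw [this, norm_div, div_lt_one (norm_pos_iff.2 hw0)]
    exact h z hz

lemma isOpen_poleRemovable (hX : IsCompact X) (hXΩ : X ⊆ Ω) :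
    IsOpen {w | PoleRemovable Ω X w} := by
  rw [isOpen_iff_mem_nhds]
  rintro w ⟨e, he, hl⟩
  have hgc : DifferentiableOn ℂ (fun z => 1 - (z - w) * e z) Ω := by fun_prop
  obtain ⟨r, hr0, hr1, hr⟩ :=
    exists_norm_le_of_forall_norm_lt hX (hgc.continuousOn.mono hXΩ) one_pos hl
  obtain ⟨C, hC⟩ := hX.exists_bound_of_continuousOn (he.continuousOn.mono hXΩ)
  have ht : Tendsto (fun w' => r + ‖w' - w‖ * C) (𝓝 w) (𝓝 (r + ‖w - w‖ * C)) :=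
    Continuous.tendsto (by fun_prop) w
  rw [sub_self, norm_zero, zero_mul, add_zero] at ht
  filter_upwards [ht.eventually (gt_mem_nhds hr1)] with w' hw'
  refine ⟨e, he, fun z hz => ?_⟩
  have : 1 - (z - w') * e z = (1 - (z - w) * e z) + (w' - w) * e z := by ring
  rw [this]
  refine (norm_add_le _ _).trans_lt (lt_of_le_of_lt ?_ hw')
  rw [norm_mul]
  gcongr
  · exact hr z hz
  · exact hC z hz

lemma PoleRemovable.of_mem_closure (hX : IsCompact X) (hXΩ : X ⊆ Ω) (hw : w ∉ X)
    (h : w ∈ closure {w | PoleRemovable Ω X w}) : PoleRemovable Ω X w := by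
  refine .of_approx hX hw fun ε hε => ?_
  rcases X.eq_empty_or_nonempty with rfl | hne
  · exact ⟨0, differentiableOn_const 0, by simp⟩
  have hd : 0 < infDist w X := (hX.isClosed.notMem_iff_infDist_pos hne).1 hw
  set d := infDist w X
  obtain ⟨w', hw', hdist⟩ := Metric.mem_closure_iff.1 h (min (d / 2) (ε / 2 * (d / 2 * d)))
    (by positivity)
  obtain ⟨e, he, hl⟩ := PoleRemovable.approx hX hXΩ hw' (half_pos hε)
  refine ⟨e, he, fun z hz => ?_⟩
  have h1 : d ≤ ‖z - w‖ := by
    rw [← dist_eq_norm, dist_comm]; exact infDist_le_dist_of_mem hz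
  have hww : ‖w - w'‖ < d / 2 := by
    rw [← dist_eq_norm]; exact hdist.trans_le (min_le_left _ _)
  have hww2 : ‖w - w'‖ < ε / 2 * (d / 2 * d) := by
    rw [← dist_eq_norm]; exact hdist.trans_le (min_le_right _ _)
  have h2 : d / 2 ≤ ‖z - w'‖ := by
    have := norm_sub_norm_le (z - w) (w' - w)
    rw [sub_sub_sub_cancel_right, norm_sub_rev w' w] at this
    linarith
  have hn1 : z - w ≠ 0 := norm_pos_iff.1 (hd.trans_le h1)
  have hn2 : z - w' ≠ 0 := norm_pos_iff.1 ((half_pos hd).trans_le h2)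
  have h3 : ‖(z - w')⁻¹ - (z - w)⁻¹‖ ≤ ε / 2 := by
    rw [inv_sub_inv hn2 hn1, norm_div, norm_mul, sub_sub_sub_cancel_left, norm_sub_rev,
      div_le_iff₀ (by positivity)]
    refine hww2.le.trans ?_
    gcongr
  calc ‖e z - (z - w)⁻¹‖ = ‖(e z - (z - w')⁻¹) + ((z - w')⁻¹ - (z - w)⁻¹)‖ := by
        rw [sub_add_sub_cancel]
    _ ≤ _ := norm_add_le _ _
    _ < ε / 2 + ε / 2 := add_lt_add_of_lt_of_le (hl z hz) h3
    _ = ε := add_halves ε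

/-- The points off `X` whose pole cannot be removed form a bounded open subset of `Ω` with
boundary in `X`. -/
lemma nonremovable_spec (hX : IsCompact X) (hXΩ : X ⊆ Ω) :
    let V := {w | w ∉ X ∧ ¬ PoleRemovable Ω X w}
    IsOpen V ∧ Bornology.IsBounded V ∧ V ⊆ Ω ∧ closure V ⊆ V ∪ X := by
  intro V
  refine ⟨?_, ?_, ?_, ?_⟩
  · rw [isOpen_iff_mem_nhds]
    rintro w ⟨hw, hn⟩
    have : w ∉ closure {w | PoleRemovable Ω X w} := fun h => hn (.of_mem_closure hX hXΩ hw h)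
    filter_upwards [hX.isClosed.isOpen_compl.mem_nhds hw,
      isClosed_closure.isOpen_compl.mem_nhds this] with w' h1 h2
    exact ⟨h1, fun h => h2 (subset_closure h)⟩
  · obtain ⟨R, hR⟩ := hX.isBounded.subset_closedBall 0
    refine (isBounded_closedBall (x := (0 : ℂ)) (r := R)).subset fun w hw => ?_
    by_contra h
    refine hw.2 (.of_norm_lt fun z hz => ?_)
    have := hR hz
    simp only [mem_closedBall, dist_zero_right, not_le] at this h
    linarith
  · intro w hw
    by_contra h
    exact hw.2 (.of_notMem hXΩ h)
  · intro w hw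
    by_cases hwX : w ∈ X
    · exact .inr hwX
    · refine .inl ⟨hwX, fun hr => ?_⟩
      obtain ⟨w', h1, h2⟩ := mem_closure_iff.1 hw _ (isOpen_poleRemovable hX hXΩ) hr
      exact h2.2 h1

lemma HolConvex.inter (hX : HolConvex Ω X) (hY : HolConvex Ω Y) : HolConvex Ω (X ∩ Y) := by
  intro w hw
  by_cases h : w ∈ X
  · exact (hY w fun h' => hw ⟨h, h'⟩).mono inter_subset_right
  · exact (hX w h).mono inter_subset_left

/-- The hull of `X` with respect to the holomorphic functions on `Ω`. -/
def holHull (Ω X : Set ℂ) : Set ℂ := {w | ¬ PoleRemovable Ω X w}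

lemma subset_holHull : X ⊆ holHull Ω X := fun _ hw h => h.notMem hw

lemma holHull_subset (hXΩ : X ⊆ Ω) : holHull Ω X ⊆ Ω := fun _ hw => by
  by_contra h
  exact hw (.of_notMem hXΩ h)

lemma isCompact_holHull (hX : IsCompact X) (hXΩ : X ⊆ Ω) : IsCompact (holHull Ω X) := by
  obtain ⟨-, hb, -, -⟩ := nonremovable_spec hX hXΩ
  refine Metric.isCompact_of_isClosed_isBounded (isOpen_poleRemovable hX hXΩ).isClosed_compl ?_
  refine (hb.union hX.isBounded).subset fun w hw => ?_
  by_cases h : w ∈ X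
  · exact .inr h
  · exact .inl ⟨h, hw⟩

lemma holConvex_holHull (hΩ : IsOpen Ω) (hXΩ : X ⊆ Ω) :
    HolConvex Ω (holHull Ω X) := by
  intro w hw
  obtain ⟨e, he, hl⟩ := not_not.1 hw
  have hgc : DifferentiableOn ℂ (fun z => 1 - (z - w) * e z) Ω := by fun_prop
  refine ⟨e, he, fun z hz => ?_⟩
  by_contra h
  exact hz (.of_separated hΩ (holHull_subset hXΩ hz) hgc
    fun x hx => (hl x hx).trans_le (not_lt.1 h))

/-- A polynomially convex compact set has arbitrarily small polynomially convex compact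
neighbourhoods. -/
lemma HolConvex.exists_compact_nhd {K U : Set ℂ} (hK : IsCompact K) (hc : HolConvex univ K)
    (hU : IsOpen U) (hKU : K ⊆ U) :
    ∃ K', IsCompact K' ∧ HolConvex univ K' ∧ K ⊆ interior K' ∧ K' ⊆ U := by
  obtain ⟨R, hR0, hR⟩ : ∃ R, 0 < R ∧ K ⊆ ball 0 R := by
    obtain ⟨R, hR⟩ := hK.isBounded.subset_ball 0
    exact ⟨max R 1, by positivity, hR.trans (ball_subset_ball (le_max_left _ _))⟩
  have hball : HolConvex univ (closedBall 0 R) := by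
    intro w hw
    refine .of_norm_lt fun z hz => ?_
    simp only [mem_closedBall, dist_zero_right, not_le] at hz hw
    linarith
  have key := ((isCompact_closedBall (0 : ℂ) R).diff hU).induction_on
    (p := fun S => ∃ K', IsCompact K' ∧ HolConvex univ K' ∧ K ⊆ interior K' ∧
      K' ⊆ closedBall 0 R ∧ Disjoint K' S)
    ⟨closedBall 0 R, isCompact_closedBall _ _, hball,
      hR.trans ball_subset_interior_closedBall, le_rfl, disjoint_empty _⟩
    (fun S T hST ⟨K', h1, h2, h3, h4, h5⟩ => ⟨K', h1, h2, h3, h4, h5.mono_right hST⟩)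
    (fun S T ⟨K', h1, h2, h3, h4, h5⟩ ⟨L', i1, i2, i3, i4, i5⟩ => ⟨K' ∩ L', h1.inter i1,
      h2.inter i2, by rw [interior_inter]; exact subset_inter h3 i3,
      inter_subset_left.trans h4, disjoint_union_right.2
        ⟨h5.mono_left inter_subset_left, i5.mono_left inter_subset_right⟩⟩)
    (fun w hw => by
      obtain ⟨e, he, hl⟩ := hc w fun h => hw.2 (hKU h)
      rw [differentiableOn_univ] at he
      set g : ℂ → ℂ := fun z => 1 - (z - w) * e z with hg
      have hgd : Differentiable ℂ g := by fun_prop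
      obtain ⟨r, hr0, hr1, hr⟩ :=
        exists_norm_le_of_forall_norm_lt hK hgd.continuous.continuousOn one_pos hl
      obtain ⟨s, hrs, hs1⟩ := exists_between hr1
      refine ⟨{z | s < ‖g z‖}, mem_nhdsWithin_of_mem_nhds
        ((isOpen_lt continuous_const hgd.continuous.norm).mem_nhds (by simpa [hg] using hs1)),
        closedBall 0 R ∩ {z | ‖g z‖ ≤ s}, ?_, ?_, ?_, inter_subset_left, ?_⟩
      · exact (isCompact_closedBall _ _).inter_right
          (isClosed_le hgd.continuous.norm continuous_const)
      · refine hball.inter fun x hx => ?_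
        exact .of_separated isOpen_univ (mem_univ x) hgd.differentiableOn
          fun z hz => lt_of_le_of_lt hz (not_le.1 hx)
      · rw [interior_inter]
        refine subset_inter (hR.trans ball_subset_interior_closedBall) ?_
        refine Subset.trans (fun z hz => (hr z hz).trans_lt hrs :
          K ⊆ {z | ‖g z‖ < s}) (interior_maximal (fun z hz => by simp only [mem_ofPred_eq] at *; exact le_of_lt hz)
            (isOpen_lt hgd.continuous.norm continuous_const))
      · rw [disjoint_left]
        rintro z ⟨-, hz⟩ hz'
        simp only [mem_ofPred_eq] at hz hz'
        linarith)
  obtain ⟨K', h1, h2, h3, h4, h5⟩ := key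
  refine ⟨K', h1, h2, h3, fun z hz => ?_⟩
  by_contra h
  exact disjoint_left.1 h5 hz ⟨h4 hz, h⟩

end Poles

section Runge

open MeasureTheory
open scoped ContDiff Manifold

/-- Twice the Wirtinger derivative `∂F/∂z`. -/
noncomputable def dpar (F : ℂ → ℂ) (w : ℂ) : ℂ :=
  fderiv ℝ F w 1 - Complex.I * fderiv ℝ F w Complex.I

lemma contDiff_indicator {S : Set ℂ} (hS : IsOpen S) {F : ℂ → ℂ} {n : WithTop ℕ∞}
    (hF : ContDiffOn ℝ n F S) (h0 : ∀ x ∉ S, ∀ᶠ y in 𝓝 x, y ∈ S → F y = 0) :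
    ContDiff ℝ n (S.indicator F) := by
  rw [contDiff_iff_contDiffAt]
  intro x
  by_cases hx : x ∈ S
  · refine (hF.contDiffAt (hS.mem_nhds hx)).congr_of_eventuallyEq ?_
    filter_upwards [hS.mem_nhds hx] with y hy
    exact indicator_of_mem hy F
  · refine (contDiffAt_const (c := (0 : ℂ))).congr_of_eventuallyEq ?_
    filter_upwards [h0 x hx] with y hy
    by_cases hyS : y ∈ S
    · rw [indicator_of_mem hyS, hy hyS]
    · exact indicator_of_notMem hyS F

lemma hasCompactSupport_indicator {S : Set ℂ} (hS : Bornology.IsBounded S) (F : ℂ → ℂ) :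
    HasCompactSupport (S.indicator F) := by
  obtain ⟨R, hR⟩ := hS.subset_closedBall 0
  exact .of_support_subset_isCompact (isCompact_closedBall 0 R) (support_indicator_subset.trans hR)

lemma contDiffOn_real_of_differentiableOn {S : Set ℂ} (hS : IsOpen S) {g : ℂ → ℂ}
    (hg : DifferentiableOn ℂ g S) {n : WithTop ℕ∞} : ContDiffOn ℝ n g S :=
  (hg.contDiffOn hS).restrict_scalars ℝ

lemma fderiv_real_eq_deriv_mul {g : ℂ → ℂ} {w : ℂ} (hg : DifferentiableAt ℂ g w) (v : ℂ) :
    fderiv ℝ g w v = deriv g w * v := by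
  rw [hg.fderiv_restrictScalars ℝ, ContinuousLinearMap.coe_restrictScalars', fderiv_eq_deriv_mul]

lemma dbar_eq_zero {g : ℂ → ℂ} {w : ℂ} (hg : DifferentiableAt ℂ g w) : dbar g w = 0 := by
  rw [dbar, fderiv_real_eq_deriv_mul hg, fderiv_real_eq_deriv_mul hg]
  linear_combination deriv g w * Complex.I_sq

lemma dbar_mul {χ g : ℂ → ℂ} {w : ℂ} (hχ : DifferentiableAt ℝ χ w) (hg : DifferentiableAt ℂ g w) :
    dbar (fun z => χ z * g z) w = dbar χ w * g w := by
  have h := dbar_eq_zero hg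
  rw [dbar] at h ⊢
  rw [fderiv_fun_mul hχ (hg.restrictScalars ℝ), dbar]
  simp only [add_apply, smul_apply, smul_eq_mul]
  linear_combination χ w * h

lemma dbar_congr {F G : ℂ → ℂ} {w : ℂ} (h : F =ᶠ[𝓝 w] G) : dbar F w = dbar G w := by
  rw [dbar, dbar, h.fderiv_eq]

lemma dpar_congr {F G : ℂ → ℂ} {w : ℂ} (h : F =ᶠ[𝓝 w] G) : dpar F w = dpar G w := by
  rw [dpar, dpar, h.fderiv_eq]

lemma contDiff_dbar {u : ℂ → ℂ} {m n : WithTop ℕ∞} (hu : ContDiff ℝ n u) (h : m + 1 ≤ n) :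
    ContDiff ℝ m (dbar u) := by
  have := hu.fderiv_right h
  unfold dbar
  fun_prop

lemma contDiff_dpar {u : ℂ → ℂ} {m n : WithTop ℕ∞} (hu : ContDiff ℝ n u) (h : m + 1 ≤ n) :
    ContDiff ℝ m (dpar u) := by
  have := hu.fderiv_right h
  unfold dpar
  fun_prop

lemma hasCompactSupport_dbar {u : ℂ → ℂ} (hu : HasCompactSupport u) :
    HasCompactSupport (dbar u) := by
  refine (hu.fderiv ℝ).mono fun w hw => ?_
  rw [Function.mem_support] at hw ⊢
  intro h
  exact hw (by simp [dbar, h])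

lemma hasCompactSupport_dpar {u : ℂ → ℂ} (hu : HasCompactSupport u) :
    HasCompactSupport (dpar u) := by
  refine (hu.fderiv ℝ).mono fun w hw => ?_
  rw [Function.mem_support] at hw ⊢
  intro h
  exact hw (by simp [dpar, h])

lemma exists_cutoff {X W : Set ℂ} (hX : IsCompact X) (hW : IsOpen W) (hXW : X ⊆ W) :
    ∃ χ : ℂ → ℂ, ContDiff ℝ ∞ χ ∧ HasCompactSupport χ ∧ tsupport χ ⊆ W ∧
      ∀ x ∈ X, ∀ᶠ y in 𝓝 x, χ y = 1 := by
  obtain ⟨K, hK, hXK, hKW⟩ := exists_compact_between hX hW hXW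
  obtain ⟨f, hf1, hf0, -⟩ := exists_contMDiffMap_one_nhds_of_subset_interior (n := (⊤ : ℕ∞))
    (𝓘(ℝ, ℂ)) hX.isClosed hXK
  have hts : tsupport (fun z => (f z : ℂ)) ⊆ K := by
    refine closure_minimal (fun z hz => ?_) hK.isClosed
    by_contra h
    exact hz (by simp [hf0 z h])
  refine ⟨fun z => (f z : ℂ), ?_, hK.of_isClosed_subset (isClosed_tsupport _) hts,
    hts.trans hKW, fun x hx => ?_⟩
  · exact Complex.ofRealCLM.contDiff.comp f.contMDiff.contDiff
  · filter_upwards [eventually_nhdsSet_iff_forall.1 hf1 x hx] with y hy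
    simp [hy]

lemma eventually_fderiv_eq_zero_of_eventually_eq {χ : ℂ → ℂ} {x c : ℂ} (h : ∀ᶠ y in 𝓝 x, χ y = c) :
    ∀ᶠ y in 𝓝 x, fderiv ℝ χ y = 0 := by
  filter_upwards [h.eventually_nhds] with y hy
  have : χ =ᶠ[𝓝 y] fun _ => c := hy
  rw [this.fderiv_eq, fderiv_fun_const]; rfl

lemma integral_mem_of_isClosed {E : Type*} [NormedAddCommGroup E] [NormedSpace ℂ E]
    [CompleteSpace E] {A : Submodule ℂ E} (hA : IsClosed (A : Set E)) {Φ : ℂ → E}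
    (hΦ : Continuous Φ) (hc : HasCompactSupport Φ) (h : ∀ w, Φ w ∈ A) : ∫ w, Φ w ∈ A := by
  have : CompleteSpace A := hA.completeSpace_coe
  have hi : Integrable (fun w => (⟨Φ w, h w⟩ : A)) := by
    refine Continuous.integrable_of_hasCompactSupport (hΦ.subtype_mk h) (hc.mono fun w hw => ?_)
    rw [Function.mem_support] at hw ⊢
    intro h0
    exact hw (Subtype.ext h0)
  have := A.subtypeL.integral_comp_comm hi
  simp only [Submodule.subtypeL_apply] at this
  rw [this]
  exact Subtype.mem _

/-- Runge's approximation theorem. -/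
theorem HolConvex.runge {Ω X W : Set ℂ} (hX : IsCompact X) (hXΩ : X ⊆ Ω) (hc : HolConvex Ω X)
    (hW : IsOpen W) (hXW : X ⊆ W) {h : ℂ → ℂ} (hh : DifferentiableOn ℂ h W)
    {ε : ℝ} (hε : 0 < ε) :
    ∃ e : ℂ → ℂ, DifferentiableOn ℂ e Ω ∧ ∀ z ∈ X, ‖e z - h z‖ < ε := by
  obtain ⟨χ, hχ, hχc, hχW, hχ1⟩ := exists_cutoff hX hW hXW
  set u := W.indicator fun z => χ z * h z with hu
  have hu1 : ContDiff ℝ 1 u := by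
    refine contDiff_indicator hW ((hχ.of_le (by exact_mod_cast le_top)).contDiffOn.mul
      (contDiffOn_real_of_differentiableOn hW hh)) fun x hx => ?_
    filter_upwards [(isClosed_tsupport χ).isOpen_compl.mem_nhds fun h => hx (hχW h)] with y hy _
    rw [image_eq_zero_of_notMem_tsupport hy, zero_mul]
  have huc : HasCompactSupport u := by
    refine hχc.mono fun w hw => ?_
    rw [Function.mem_support] at hw ⊢
    intro h0
    refine hw ?_
    by_cases hwW : w ∈ W
    · simp [hu, hwW, h0]
    · simp [hu, hwW]
  have huX : ∀ x ∈ X, u =ᶠ[𝓝 x] h := by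
    intro x hx
    filter_upwards [hW.mem_nhds (hXW hx), hχ1 x hx] with y hy h1
    rw [hu, indicator_of_mem hy, h1, one_mul]
  have hψc : Continuous (dbar u) := (contDiff_dbar hu1 (m := 0) (by simp)).continuous
  have hψX : ∀ x ∈ X, ∀ᶠ y in 𝓝 x, dbar u y = 0 := by
    intro x hx
    filter_upwards [(huX x hx).eventually_nhds, hW.mem_nhds (hXW hx)] with y hy hyW
    rw [dbar_congr hy]
    exact dbar_eq_zero (hh.differentiableAt (hW.mem_nhds hyW))
  have : CompactSpace X := isCompact_iff_compactSpace.1 hX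
  have hjc : Continuous fun p : ℂ × X => dbar u p.1 / (p.1 - p.2) := by
    rw [continuous_iff_continuousAt]
    rintro ⟨w, z⟩
    by_cases hwz : w = z
    · subst hwz
      refine (continuousAt_const (y := (0 : ℂ))).congr ?_
      filter_upwards [(hψX z z.2).filter_mono (continuous_fst.tendsto (z.1, z))] with p hp
      rw [hp, zero_div]
    · exact (hψc.comp continuous_fst).continuousAt.div (by fun_prop) (sub_ne_zero.2 hwz)
  set Φ := (ContinuousMap.mk _ hjc).curry with hΦ
  have hΦa : ∀ w (z : X), Φ w z = dbar u w / (w - z) := fun w z => rfl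
  have hΦs : HasCompactSupport Φ := by
    refine (hasCompactSupport_dbar huc).mono fun w hw => ?_
    rw [Function.mem_support] at hw ⊢
    intro h0
    exact hw (by ext z; simp [hΦa, h0])
  set A₀ : Submodule ℂ C(X, ℂ) :=
    { carrier := {a | ∃ e : ℂ → ℂ, DifferentiableOn ℂ e Ω ∧ ∀ z : X, a z = e z}
      add_mem' := by
        rintro a b ⟨e, he, hae⟩ ⟨e', he', hbe⟩
        exact ⟨fun z => e z + e' z, by fun_prop, fun z => by simp [hae, hbe]⟩
      zero_mem' := ⟨0, differentiableOn_const 0, fun z => rfl⟩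
      smul_mem' := by
        rintro c a ⟨e, he, hae⟩
        exact ⟨fun z => c * e z, by fun_prop, fun z => by simp [hae]⟩ } with hA₀
  have hΦA : ∀ w, Φ w ∈ A₀.topologicalClosure := by
    intro w
    by_cases hw : w ∈ X
    · have : Φ w = 0 := by ext z; simp [hΦa, (hψX w hw).self_of_nhds]
      rw [this]; exact zero_mem _
    · have hcont : Continuous fun z : X => ((z : ℂ) - w)⁻¹ :=
        Continuous.inv₀ (by fun_prop) fun z => sub_ne_zero.2 (ne_of_mem_of_not_mem z.2 hw)
      have : Φ w = (-dbar u w) • (ContinuousMap.mk _ hcont : C(X, ℂ)) := by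
        ext z
        rw [hΦa, ContinuousMap.smul_apply, ContinuousMap.coe_mk, smul_eq_mul, ← neg_sub (z : ℂ) w,
          div_neg, neg_mul, div_eq_mul_inv]
      rw [this]
      refine Submodule.smul_mem _ _ ?_
      rw [← SetLike.mem_coe, Submodule.topologicalClosure_coe, Metric.mem_closure_iff]
      intro δ hδ
      obtain ⟨e, he, hl⟩ := (hc w hw).approx hX hXΩ hδ
      refine ⟨⟨fun z : X => e z, continuousOn_iff_continuous_domRestrict.1
        (he.continuousOn.mono hXΩ)⟩, ⟨e, he, fun z => rfl⟩, ?_⟩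
      rw [ContinuousMap.dist_lt_iff hδ]
      intro z
      rw [dist_comm, dist_eq_norm]
      exact hl z z.2
  have hint := integral_mem_of_isClosed A₀.isClosed_topologicalClosure Φ.continuous hΦs hΦA
  have hint2 := Submodule.smul_mem _ (-(2 * Real.pi : ℂ))⁻¹ hint
  rw [← SetLike.mem_coe, Submodule.topologicalClosure_coe, Metric.mem_closure_iff] at hint2
  obtain ⟨a, ⟨e, he, hae⟩, hd⟩ := hint2 ε hε
  refine ⟨e, he, fun z hz => ?_⟩
  rw [ContinuousMap.dist_lt_iff hε] at hd
  have h1 := hd ⟨z, hz⟩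
  have hΦi : Integrable Φ := Φ.continuous.integrable_of_hasCompactSupport hΦs
  rw [hae, dist_comm, dist_eq_norm, ContinuousMap.smul_apply, ContinuousMap.integral_apply hΦi] at h1
  simp only [hΦa] at h1
  rw [cauchy_pompeiu hu1 huc, (huX z hz).self_of_nhds, smul_eq_mul,
    inv_mul_cancel_left₀ (by simp [Real.pi_ne_zero])] at h1
  exact h1

lemma dpar_dbar_comm {χ : ℂ → ℂ} (hχ : ContDiff ℝ 2 χ) (w : ℂ) :
    dpar (dbar χ) w = dbar (dpar χ) w := by
  have hd : Differentiable ℝ (fderiv ℝ χ) :=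
    (hχ.fderiv_right (m := 1) (by norm_num)).differentiable one_ne_zero
  have hsymm := (hχ.contDiffAt (x := w)).isSymmSndFDerivAt (by simp)
  have h1 : ∀ v v', fderiv ℝ (fun z => fderiv ℝ χ z v) w v' = fderiv ℝ (fderiv ℝ χ) w v' v := by
    intro v v'
    rw [fderiv_clm_apply hd.differentiableAt (by fun_prop)]
    simp
  have hdv : ∀ v, DifferentiableAt ℝ (fun z => fderiv ℝ χ z v) w := fun v => by fun_prop
  have h2 : ∀ v', fderiv ℝ (dbar χ) w v' =
      fderiv ℝ (fderiv ℝ χ) w v' 1 + Complex.I * fderiv ℝ (fderiv ℝ χ) w v' Complex.I := by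
    intro v'
    unfold dbar
    rw [fderiv_fun_add (hdv _) ((hdv _).const_mul _), fderiv_const_mul (hdv _)]
    simp [h1]
  have h3 : ∀ v', fderiv ℝ (dpar χ) w v' =
      fderiv ℝ (fderiv ℝ χ) w v' 1 - Complex.I * fderiv ℝ (fderiv ℝ χ) w v' Complex.I := by
    intro v'
    unfold dpar
    rw [fderiv_fun_sub (hdv _) ((hdv _).const_mul _), fderiv_const_mul (hdv _)]
    simp [h1]
  rw [dpar, h2, h2, dbar, h3, h3]
  linear_combination (2 * Complex.I) * hsymm.eq 1 Complex.I

lemma integrableOn_dbar_mul {S : Set ℂ} (hS : IsOpen S) (hSb : Bornology.IsBounded S)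
    {χ : ℂ → ℂ} (hχ : ContDiff ℝ ∞ χ)
    (h0 : ∀ x ∉ S, ∀ᶠ y in 𝓝 x, y ∈ S → fderiv ℝ χ y = 0) {p : ℂ → ℂ}
    (hp : DifferentiableOn ℂ p S) : IntegrableOn (fun w => dbar χ w * p w) S := by
  rw [← integrable_indicator_iff hS.measurableSet]
  refine Continuous.integrable_of_hasCompactSupport (ContDiff.continuous (𝕜 := ℝ) (n := 1)
    (contDiff_indicator hS ?_ fun x hx => ?_)) (hasCompactSupport_indicator hSb _)
  · exact (contDiff_dbar (m := 1) (n := 2) (by exact_mod_cast contDiff_infty.1 hχ 2)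
      (by norm_num)).contDiffOn.mul (contDiffOn_real_of_differentiableOn hS hp)
  · filter_upwards [h0 x hx] with y hy hyS
    simp [dbar, hy hyS]

/-- If `χ` is locally constant near the complement of `S`, the measure `∂χ/∂z̄ dA` on `S`
annihilates all derivatives of holomorphic functions. -/
lemma setIntegral_dbar_mul_deriv_eq_zero {S : Set ℂ} (hS : IsOpen S) (hSb : Bornology.IsBounded S)
    {χ : ℂ → ℂ} (hχ : ContDiff ℝ ∞ χ)
    (h0 : ∀ x ∉ S, ∀ᶠ y in 𝓝 x, y ∈ S → fderiv ℝ χ y = 0) {G : ℂ → ℂ}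
    (hG : DifferentiableOn ℂ G S) : ∫ w in S, dbar χ w * deriv G w = 0 := by
  set F₁ := S.indicator fun w => dbar χ w * G w with hF₁
  set F₂ := S.indicator fun w => dpar χ w * G w with hF₂
  have hχ2 : ContDiff ℝ 2 χ := by exact_mod_cast contDiff_infty.1 hχ 2
  have hb : ContDiff ℝ 1 (dbar χ) := contDiff_dbar hχ2 (by norm_num)
  have hp : ContDiff ℝ 1 (dpar χ) := contDiff_dpar hχ2 (by norm_num)
  have hGr : ContDiffOn ℝ 1 G S := contDiffOn_real_of_differentiableOn hS hG
  have h1 : ContDiff ℝ 1 F₁ := by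
    refine contDiff_indicator hS (hb.contDiffOn.mul hGr) fun x hx => ?_
    filter_upwards [h0 x hx] with y hy hyS
    simp [dbar, hy hyS]
  have h2 : ContDiff ℝ 1 F₂ := by
    refine contDiff_indicator hS (hp.contDiffOn.mul hGr) fun x hx => ?_
    filter_upwards [h0 x hx] with y hy hyS
    simp [dpar, hy hyS]
  have c1 : HasCompactSupport F₁ := hasCompactSupport_indicator hSb _
  have c2 : HasCompactSupport F₂ := hasCompactSupport_indicator hSb _
  have key : ∀ w, dpar F₁ w - dbar F₂ w = 2 * S.indicator (fun w => dbar χ w * deriv G w) w := by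
    intro w
    by_cases hw : w ∈ S
    · have e1 : F₁ =ᶠ[𝓝 w] fun w => dbar χ w * G w := by
        filter_upwards [hS.mem_nhds hw] with y hy using indicator_of_mem hy _
      have e2 : F₂ =ᶠ[𝓝 w] fun w => dpar χ w * G w := by
        filter_upwards [hS.mem_nhds hw] with y hy using indicator_of_mem hy _
      have hGw := hG.differentiableAt (hS.mem_nhds hw)
      rw [dpar_congr e1, dbar_congr e2, dbar_mul (hp.differentiable one_ne_zero w) hGw,
        ← dpar_dbar_comm hχ2, indicator_of_mem hw, dpar,
        fderiv_fun_mul (hb.differentiable one_ne_zero w) (hGw.restrictScalars ℝ)]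
      simp only [add_apply, smul_apply, smul_eq_mul,
        fderiv_real_eq_deriv_mul hGw, dpar]
      linear_combination (- dbar χ w * deriv G w) * Complex.I_sq
    · have e1 : F₁ =ᶠ[𝓝 w] fun _ => 0 := by
        filter_upwards [h0 w hw] with y hy
        by_cases hyS : y ∈ S
        · simp [hF₁, dbar, hy hyS]
        · exact indicator_of_notMem hyS _
      have e2 : F₂ =ᶠ[𝓝 w] fun _ => 0 := by
        filter_upwards [h0 w hw] with y hy
        by_cases hyS : y ∈ S
        · simp [hF₂, dpar, hy hyS]
        · exact indicator_of_notMem hyS _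
      rw [dpar_congr e1, dbar_congr e2, indicator_of_notMem hw]
      simp [dpar, dbar]
  have hi : ∀ {F : ℂ → ℂ}, ContDiff ℝ 1 F → HasCompactSupport F → ∀ v,
      Integrable fun w => fderiv ℝ F w v := fun hF hFc v =>
    ((hF.continuous_fderiv one_ne_zero).clm_apply continuous_const).integrable_of_hasCompactSupport
      (hFc.fderiv_apply ℝ v)
  have i1 : ∫ w, dpar F₁ w = 0 := by
    unfold dpar
    rw [integral_sub (hi h1 c1 _) ((hi h1 c1 _).const_mul _), integral_const_mul,
      integral_fderiv_apply_eq_zero h1 c1, integral_fderiv_apply_eq_zero h1 c1]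
    simp
  have i2 : ∫ w, dbar F₂ w = 0 := by
    unfold dbar
    rw [integral_add (hi h2 c2 _) ((hi h2 c2 _).const_mul _), integral_const_mul,
      integral_fderiv_apply_eq_zero h2 c2, integral_fderiv_apply_eq_zero h2 c2]
    simp
  have i3 : ∫ w, (dpar F₁ w - dbar F₂ w) = 0 := by
    rw [integral_sub, i1, i2, sub_zero]
    · exact ((contDiff_dpar h1 (m := 0) (by simp)).continuous).integrable_of_hasCompactSupport
        (hasCompactSupport_dpar c1)
    · exact ((contDiff_dbar h2 (m := 0) (by simp)).continuous).integrable_of_hasCompactSupport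
        (hasCompactSupport_dbar c2)
  simp only [key] at i3
  rw [integral_const_mul, integral_indicator hS.measurableSet] at i3
  simpa using i3

end Runge

section Conformal

variable {U : Set ℂ} {φ : ℂ → ℂ}

lemma nhds_le_map_of_injOn (hU : IsOpen U) (hφ : DifferentiableOn ℂ φ U) (hinj : InjOn φ U)
    {z : ℂ} (hz : z ∈ U) : 𝓝 (φ z) ≤ map φ (𝓝 z) := by
  refine (hφ.analyticAt (hU.mem_nhds hz)).eventually_constant_or_nhds_le_map_nhds.resolve_left
    fun h => ?_
  have h1 : ∀ᶠ y in 𝓝[≠] z, y = z := by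
    filter_upwards [nhdsWithin_le_nhds h, nhdsWithin_le_nhds (hU.mem_nhds hz)] with y hy hyU
    exact hinj hyU hz hy
  obtain ⟨y, hy1, hy2⟩ := (h1.and self_mem_nhdsWithin).exists
  exact hy2 hy1

lemma isOpen_image_of_injOn (hU : IsOpen U) (hφ : DifferentiableOn ℂ φ U) (hinj : InjOn φ U)
    {V : Set ℂ} (hV : IsOpen V) (hVU : V ⊆ U) : IsOpen (φ '' V) := by
  rw [isOpen_iff_mem_nhds]
  rintro _ ⟨z, hz, rfl⟩
  exact nhds_le_map_of_injOn hU hφ hinj (hVU hz) (image_mem_map (hV.mem_nhds hz))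

lemma continuousAt_invFunOn (hU : IsOpen U) (hφ : DifferentiableOn ℂ φ U) (hinj : InjOn φ U)
    {z : ℂ} (hz : z ∈ U) : ContinuousAt (Function.invFunOn φ U) (φ z) := by
  have h1 : Function.invFunOn φ U ∘ φ =ᶠ[𝓝 z] id := by
    filter_upwards [hU.mem_nhds hz] with y hy using hinj.leftInvOn_invFunOn hy
  have h2 : Tendsto (Function.invFunOn φ U ∘ φ) (𝓝 z) (𝓝 z) := tendsto_id.congr' h1.symm
  rw [ContinuousAt, hinj.leftInvOn_invFunOn hz]
  exact (tendsto_map'_iff.2 h2).mono_left (nhds_le_map_of_injOn hU hφ hinj hz)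

/-- The inverse of an injective holomorphic function is holomorphic. -/
lemma differentiableOn_invFunOn (hU : IsOpen U) (hφ : DifferentiableOn ℂ φ U) (hinj : InjOn φ U) :
    DifferentiableOn ℂ (Function.invFunOn φ U) (φ '' U) := by
  rintro _ ⟨z, hz, rfl⟩
  refine DifferentiableAt.differentiableWithinAt ?_
  have hd : AnalyticAt ℂ (deriv φ) z := (hφ.analyticAt (hU.mem_nhds hz)).deriv
  have hne : ∀ᶠ y in 𝓝[≠] z, deriv φ y ≠ 0 := by
    refine hd.eventually_eq_zero_or_eventually_ne_zero.resolve_left fun h => ?_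
    obtain ⟨r, hr, hb⟩ := Metric.eventually_nhds_iff_ball.1
      (h.and (hU.mem_nhds hz : ∀ᶠ y in 𝓝 z, y ∈ U))
    have hzb : z ∈ Metric.ball z r := Metric.mem_ball_self hr
    have hc : ∀ y ∈ Metric.ball z r, φ y = φ z := fun y hy =>
      Metric.isOpen_ball.is_const_of_deriv_eq_zero (convex_ball z r).isPreconnected
        (hφ.mono fun y hy => (hb y hy).2) (fun y hy => (hb y hy).1) hy hzb
    have h1 : ∀ᶠ y in 𝓝[≠] z, y = z := by
      filter_upwards [nhdsWithin_le_nhds (Metric.ball_mem_nhds z hr)] with y hy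
      exact hinj (hb y hy).2 hz (hc y hy)
    obtain ⟨y, hy1, hy2⟩ := (h1.and self_mem_nhdsWithin).exists
    exact hy2 hy1
  obtain ⟨N, hN, hNn⟩ := mem_nhdsWithin_iff_exists_mem_nhds_inter.1 hne
  have hmem : φ '' (N ∩ U) ∈ 𝓝 (φ z) :=
    nhds_le_map_of_injOn hU hφ hinj hz (image_mem_map (inter_mem hN (hU.mem_nhds hz)))
  refine (Complex.differentiableOn_compl_singleton_and_continuousAt_iff hmem).1
    ⟨?_, continuousAt_invFunOn hU hφ hinj hz⟩ |>.differentiableAt hmem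
  rintro _ ⟨⟨y, ⟨hyN, hyU⟩, rfl⟩, hyz⟩
  have hyne : y ≠ z := fun h => hyz (by rw [h]; rfl)
  refine DifferentiableAt.differentiableWithinAt (HasDerivAt.differentiableAt
    (HasDerivAt.of_local_left_inverse (continuousAt_invFunOn hU hφ hinj hyU)
      (f := φ) (f' := deriv φ y) ?_ (hNn ⟨hyN, hyne⟩) ?_))
  · rw [hinj.leftInvOn_invFunOn hyU]
    exact (hφ.differentiableAt (hU.mem_nhds hyU)).hasDerivAt
  · have := (isOpen_image_of_injOn hU hφ hinj hU le_rfl).mem_nhds (mem_image_of_mem φ hyU)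
    filter_upwards [this] with w hw
    exact Function.invFunOn_eq hw

lemma deriv_invFunOn_mul_deriv (hU : IsOpen U) (hφ : DifferentiableOn ℂ φ U) (hinj : InjOn φ U)
    {z : ℂ} (hz : z ∈ U) : deriv (Function.invFunOn φ U) (φ z) * deriv φ z = 1 := by
  have h1 : HasDerivAt φ (deriv φ z) z := (hφ.differentiableAt (hU.mem_nhds hz)).hasDerivAt
  have h2 := ((differentiableOn_invFunOn hU hφ hinj).differentiableAt
    ((isOpen_image_of_injOn hU hφ hinj hU le_rfl).mem_nhds (mem_image_of_mem φ hz))).hasDerivAt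
  have h3 := h2.comp z h1
  refine h3.unique ((hasDerivAt_id z).congr_of_eventuallyEq ?_)
  filter_upwards [hU.mem_nhds hz] with y hy using hinj.leftInvOn_invFunOn hy

open MeasureTheory
open scoped ContDiff

/-- Holomorphic functions near a conformal image of a polynomially convex set `K` are limits of
derivatives there, and hence annihilated by `∂χ/∂z̄ dA` if `χ` is locally constant near the
complement of `S`. -/
lemma setIntegral_dbar_mul_eq_zero_of_image (hU : IsOpen U) (hφ : DifferentiableOn ℂ φ U)
    (hinj : InjOn φ U) {K S : Set ℂ} (hK : IsCompact K) (hKc : HolConvex univ K) (hKU : K ⊆ U)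
    (hS : IsOpen S) (hSb : Bornology.IsBounded S) (hSK : S ⊆ φ '' K) {χ : ℂ → ℂ}
    (hχ : ContDiff ℝ ∞ χ) (h0 : ∀ x ∉ S, ∀ᶠ y in 𝓝 x, y ∈ S → fderiv ℝ χ y = 0) {h : ℂ → ℂ}
    (hh : DifferentiableOn ℂ h (φ '' U)) : ∫ w in S, dbar χ w * h w = 0 := by
  set ζ := Function.invFunOn φ U with hζ
  have hζd : DifferentiableOn ℂ ζ (φ '' U) := differentiableOn_invFunOn hU hφ hinj
  have hSU : S ⊆ φ '' U := hSK.trans (image_mono hKU)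
  have hoU := isOpen_image_of_injOn hU hφ hinj hU le_rfl
  have hζ' : DifferentiableOn ℂ (deriv ζ) S := (hζd.deriv hoU).mono hSU
  have hφ' : DifferentiableOn ℂ (deriv φ) U := hφ.deriv hU
  have hζS : ∀ w ∈ S, ζ w ∈ K := by
    intro w hw
    obtain ⟨z, hz, rfl⟩ := hSK hw
    rwa [hζ, hinj.leftInvOn_invFunOn (hKU hz)]
  have hq : DifferentiableOn ℂ (fun z => h (φ z) * deriv φ z) U :=
    (hh.comp hφ (mapsTo_image φ U)).mul hφ'
  have hhi := integrableOn_dbar_mul hS hSb hχ h0 (hh.mono hSU)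
  have hCi := (integrableOn_dbar_mul hS hSb hχ h0 hζ').norm
  set C := ∫ w in S, ‖dbar χ w * deriv ζ w‖ with hC
  have hC0 : 0 ≤ C := integral_nonneg fun _ => norm_nonneg _
  have key : ∀ ε > 0, ‖∫ w in S, dbar χ w * h w‖ ≤ ε * C := by
    intro ε hε
    obtain ⟨e, he, hl⟩ := hKc.runge hK (subset_univ K) hU hKU hq hε
    rw [differentiableOn_univ] at he
    obtain ⟨Q, hQ⟩ := he.isExactOn_univ
    have hQ' : ∀ z, HasDerivAt Q (e z) z := fun z => hQ z (mem_univ z)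
    have hGd : ∀ w ∈ S, HasDerivAt (fun w => Q (ζ w)) (e (ζ w) * deriv ζ w) w := fun w hw =>
      (hQ' (ζ w)).comp w (hζd.differentiableAt (hoU.mem_nhds (hSU hw))).hasDerivAt
    have hG0 := setIntegral_dbar_mul_deriv_eq_zero hS hSb hχ h0 (G := fun w => Q (ζ w))
      fun w hw => (hGd w hw).differentiableAt.differentiableWithinAt
    have hei := integrableOn_dbar_mul hS hSb hχ h0 (p := fun w => e (ζ w) * deriv ζ w)
      ((he.comp_differentiableOn (hζd.mono hSU)).mul hζ')
    rw [setIntegral_congr_fun (g := fun w => dbar χ w * (e (ζ w) * deriv ζ w)) hS.measurableSet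
      fun w hw => by simp only [(hGd w hw).deriv]] at hG0
    rw [← sub_zero (∫ w in S, dbar χ w * h w), ← hG0, ← integral_sub hhi hei, hC,
      ← integral_const_mul]
    refine norm_integral_le_of_norm_le (hCi.const_mul ε) ?_
    rw [ae_restrict_iff' hS.measurableSet]
    refine .of_forall fun w hw => ?_
    have hK' := hl (ζ w) (hζS w hw)
    obtain ⟨z, hz, rfl⟩ := hSU hw
    have hzz : ζ (φ z) = z := hinj.leftInvOn_invFunOn hz
    have h1 := deriv_invFunOn_mul_deriv hU hφ hinj hz
    rw [← hζ] at h1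
    rw [hzz] at hK' ⊢
    have : dbar χ (φ z) * h (φ z) - dbar χ (φ z) * (e z * deriv ζ (φ z)) =
        -((e z - h (φ z) * deriv φ z) * (dbar χ (φ z) * deriv ζ (φ z))) := by
      linear_combination (-dbar χ (φ z) * h (φ z)) * h1
    rw [this, norm_neg, norm_mul]
    gcongr
  rw [← norm_le_zero_iff]
  refine le_of_forall_pos_le_add fun δ hδ => ?_
  have h1 := key (δ / (C + 1)) (by positivity)
  have h2 : δ / (C + 1) * C ≤ δ := by
    rw [div_mul_eq_mul_div, div_le_iff₀ (by positivity)]; nlinarith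
  linarith

/-- The union of a convex set and a disjoint conformal image of a polynomially convex set is
convex again. -/
theorem HolConvex.union_image {Ω L K : Set ℂ} (hΩ : IsOpen Ω) (hL : IsCompact L) (hLΩ : L ⊆ Ω)
    (hLc : HolConvex Ω L) (hK : IsCompact K) (hKc : HolConvex univ K) (hU : IsOpen U)
    (hKU : K ⊆ U) (hφ : DifferentiableOn ℂ φ U) (hinj : InjOn φ U) (hKΩ : φ '' K ⊆ Ω)
    (hdisj : Disjoint L (φ '' K)) : HolConvex Ω (L ∪ φ '' K) := by
  intro w₀ hw₀
  by_contra hn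
  set X := L ∪ φ '' K with hXdef
  have hX : IsCompact X := hL.union (hK.image_of_continuousOn (hφ.continuousOn.mono hKU))
  have hXΩ : X ⊆ Ω := union_subset hLΩ hKΩ
  obtain ⟨hVo, hVb, hVΩ, hVX⟩ := nonremovable_spec hX hXΩ
  set V := {w | w ∉ X ∧ ¬ PoleRemovable Ω X w}
  have hwV : w₀ ∈ V := ⟨hw₀, hn⟩
  obtain ⟨e, he, hl⟩ := hLc w₀ fun h => hw₀ (.inl h)
  set g : ℂ → ℂ := fun z => 1 - (z - w₀) * e z with hg
  have hgd : DifferentiableOn ℂ g Ω := by fun_prop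
  have hgw : g w₀ = 1 := by simp [hg]
  obtain ⟨r, hr0, hr1, hr⟩ :=
    exists_norm_le_of_forall_norm_lt hL (hgd.continuousOn.mono hLΩ) one_pos hl
  obtain ⟨s, hrs, hs1⟩ := exists_between hr1
  have hs0 : 0 ≤ s := hr0.trans hrs.le
  -- neighbourhoods of the two pieces
  set U' := U ∩ φ ⁻¹' (Ω \ ({w₀} ∪ L)) with hU'def
  have hU' : IsOpen U' := hφ.continuousOn.isOpen_inter_preimage hU
    (hΩ.sdiff (isClosed_singleton.union hL.isClosed))
  have hKU' : K ⊆ U' := fun z hz => ⟨hKU hz, hKΩ (mem_image_of_mem φ hz), fun h => by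
    rcases h with h | h
    · exact hw₀ (.inr ⟨z, hz, h⟩)
    · exact disjoint_left.1 hdisj h (mem_image_of_mem φ hz)⟩
  have hU'U : U' ⊆ U := inter_subset_left
  obtain ⟨K', hK', hK'c, hKK', hK'U⟩ := hKc.exists_compact_nhd hK hU' hKU'
  have hφ' := hφ.mono hU'U
  have hinj' := hinj.mono hU'U
  have hφK' : IsClosed (φ '' K') :=
    (hK'.image_of_continuousOn (hφ'.continuousOn.mono hK'U)).isClosed
  set NB := φ '' interior K' with hNB
  have hNBo : IsOpen NB :=
    isOpen_image_of_injOn hU' hφ' hinj' isOpen_interior (interior_subset.trans hK'U)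
  set NL := (Ω ∩ g ⁻¹' Metric.ball 0 s) \ φ '' K' with hNL
  have hNLo : IsOpen NL :=
    (hgd.continuousOn.isOpen_inter_preimage hΩ Metric.isOpen_ball).sdiff hφK'
  have hNd : Disjoint NL NB := disjoint_left.2 fun z hz hz' =>
    hz.2 (image_mono interior_subset hz')
  have hXN : X ⊆ NL ∪ NB := by
    rintro z (hz | ⟨y, hy, rfl⟩)
    · refine .inl ⟨⟨hLΩ hz, ?_⟩, ?_⟩
      · simpa using (hr z hz).trans_lt hrs
      · rintro ⟨y, hy, rfl⟩
        exact (hK'U hy).2.2 (.inr hz)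
    · exact .inr ⟨y, hKK' hy, rfl⟩
  have hwNL : w₀ ∉ NL := by
    rintro ⟨⟨-, h⟩, -⟩
    simp only [mem_preimage, mem_ball_zero_iff, hgw, norm_one] at h
    linarith
  have hwU' : w₀ ∉ φ '' U' := by
    rintro ⟨y, hy, h⟩
    exact hy.2.2 (.inl h)
  have hNBU' : NB ⊆ φ '' U' := image_mono (interior_subset.trans hK'U)
  have hU'Ω : φ '' U' ⊆ Ω \ {w₀} := by
    rintro _ ⟨y, hy, rfl⟩
    exact ⟨hy.2.1, fun h => hy.2.2 (.inl h)⟩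
  have hNLΩ : NL ⊆ Ω \ {w₀} := fun z hz => ⟨hz.1.1, fun h => hwNL (h ▸ hz)⟩
  obtain ⟨χ, hχ, hχc, hχN, hχ1⟩ := exists_cutoff hX (hNLo.union hNBo) hXN
  have hχd : Differentiable ℝ χ := hχ.differentiable (by simp)
  have hwχ : w₀ ∉ tsupport χ := fun h => by
    rcases hχN h with h | h
    · exact hwNL h
    · exact hwU' (hNBU' h)
  have hoff : ∀ x ∉ V, x ∉ X → ∀ᶠ y in 𝓝 x, y ∉ V := fun x hxV hxX => by
    filter_upwards [isClosed_closure.isOpen_compl.mem_nhds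
      (fun h => (hVX h).elim hxV hxX : x ∉ closure V)] with y hy hyV
    exact hy (subset_closure hyV)
  have hχoff : ∀ x ∉ tsupport χ, ∀ᶠ y in 𝓝 x, χ y = 0 := fun x hx => by
    filter_upwards [(isClosed_tsupport χ).isOpen_compl.mem_nhds hx] with y hy
    exact image_eq_zero_of_notMem_tsupport hy
  have aux : ∀ N N' : Set ℂ, IsOpen N' → Disjoint N N' → tsupport χ ⊆ N ∪ N' →
      ∀ x ∉ V ∩ N, ∀ᶠ y in 𝓝 x, y ∈ V ∩ N → fderiv ℝ χ y = 0 := by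
    intro N N' hN' hNN hsub x hx
    by_cases hxV : x ∈ V
    · by_cases hxN' : x ∈ N'
      · filter_upwards [hN'.mem_nhds hxN'] with y hy hyN
        exact absurd hy (disjoint_left.1 hNN hyN.2)
      · have : x ∉ tsupport χ := fun h => (hsub h).elim (fun h => hx ⟨hxV, h⟩) hxN'
        filter_upwards [eventually_fderiv_eq_zero_of_eventually_eq (hχoff x this)] with y hy _
          using hy
    · by_cases hxX : x ∈ X
      · filter_upwards [eventually_fderiv_eq_zero_of_eventually_eq (hχ1 x hxX)] with y hy _
          using hy
      · filter_upwards [hoff x hxV hxX] with y hy hyV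
        exact absurd hyV.1 hy
  have auxL := aux NL NB hNBo hNd hχN
  have auxB := aux NB NL hNLo hNd.symm (by rwa [union_comm])
  have hSL : IsOpen (V ∩ NL) := hVo.inter hNLo
  have hSB : IsOpen (V ∩ NB) := hVo.inter hNBo
  have hSLb : Bornology.IsBounded (V ∩ NL) := hVb.subset inter_subset_left
  have hSBb : Bornology.IsBounded (V ∩ NB) := hVb.subset inter_subset_left
  have hpd : ∀ k : ℕ, DifferentiableOn ℂ (fun w => g w ^ k * (w - w₀)⁻¹) (Ω \ {w₀}) := fun k =>
    ((hgd.mono sdiff_subset).pow k).mul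
      (DifferentiableOn.inv (by fun_prop) fun z hz => sub_ne_zero.2 hz.2)
  have hmain : ∀ k : ℕ, ∫ w in V ∩ NL, dbar χ w * (g w ^ k * (w - w₀)⁻¹) = 2 * Real.pi := by
    intro k
    set u := V.indicator fun w => (1 - χ w) * g w ^ k with hu
    have hgk : DifferentiableOn ℂ (fun w => g w ^ k) V := (hgd.mono hVΩ).pow k
    have hu1 : ContDiff ℝ 1 u := by
      refine contDiff_indicator hVo ((contDiff_const.sub
        (hχ.of_le (by exact_mod_cast le_top))).contDiffOn.mul
        (contDiffOn_real_of_differentiableOn hVo hgk)) fun x hx => ?_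
      by_cases hxX : x ∈ X
      · filter_upwards [hχ1 x hxX] with y hy _
        simp [hy]
      · filter_upwards [hoff x hx hxX] with y hy hyV
        exact absurd hyV hy
    have huw : u w₀ = 1 := by
      rw [hu, indicator_of_mem hwV, hgw, image_eq_zero_of_notMem_tsupport hwχ]; simp
    have hdu : ∀ w, dbar u w = -V.indicator (fun w => dbar χ w * g w ^ k) w := by
      intro w
      by_cases hw : w ∈ V
      · have e1 : u =ᶠ[𝓝 w] fun w => (1 - χ w) * g w ^ k := by
          filter_upwards [hVo.mem_nhds hw] with y hy using indicator_of_mem hy _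
        rw [dbar_congr e1, dbar_mul (by fun_prop) (hgk.differentiableAt (hVo.mem_nhds hw)),
          indicator_of_mem hw]
        have : dbar (fun w => 1 - χ w) w = -dbar χ w := by
          simp only [dbar, fderiv_const_sub, neg_apply]
          ring
        rw [this, neg_mul]
      · have e1 : u =ᶠ[𝓝 w] fun _ => 0 := by
          by_cases hxX : w ∈ X
          · filter_upwards [hχ1 w hxX] with y hy
            simp [hu, hy]
          · filter_upwards [hoff w hw hxX] with y hy
            exact indicator_of_notMem hy _
        rw [dbar_congr e1, indicator_of_notMem hw]
        simp [dbar]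
    have hcp := cauchy_pompeiu hu1 (hasCompactSupport_indicator hVb _) w₀
    have h1 : ∀ w, dbar u w / (w - w₀) =
        -V.indicator (fun w => dbar χ w * (g w ^ k * (w - w₀)⁻¹)) w := by
      intro w
      rw [hdu]
      by_cases hw : w ∈ V
      · rw [indicator_of_mem hw, indicator_of_mem hw, div_eq_mul_inv]; ring
      · simp [indicator_of_notMem hw]
    simp only [h1] at hcp
    rw [integral_neg, integral_indicator hVo.measurableSet, huw, mul_one, neg_inj] at hcp
    have h2 : ∫ w in V, dbar χ w * (g w ^ k * (w - w₀)⁻¹) =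
        ∫ w in (V ∩ NL) ∪ (V ∩ NB), dbar χ w * (g w ^ k * (w - w₀)⁻¹) := by
      refine setIntegral_eq_of_subset_of_forall_sdiff_eq_zero hVo.measurableSet
        (union_subset inter_subset_left inter_subset_left) fun x hx => ?_
      have : x ∉ tsupport χ := fun h => hx.2 <| by
        rw [← inter_union_distrib_left]
        exact ⟨hx.1, hχN h⟩
      have h3 := (eventually_fderiv_eq_zero_of_eventually_eq (hχoff x this)).self_of_nhds
      simp [dbar, h3]
    rw [h2, setIntegral_union (hNd.mono inter_subset_right inter_subset_right) hSB.measurableSet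
      (integrableOn_dbar_mul hSL hSLb hχ auxL
        ((hpd k).mono (inter_subset_right.trans hNLΩ)))
      (integrableOn_dbar_mul hSB hSBb hχ auxB
        ((hpd k).mono (inter_subset_right.trans (hNBU'.trans hU'Ω)))),
      setIntegral_dbar_mul_eq_zero_of_image hU' hφ' hinj' hK' hK'c hK'U hSB hSBb
        (inter_subset_right.trans (image_mono interior_subset)) hχ auxB ((hpd k).mono hU'Ω),
      add_zero] at hcp
    exact hcp
  have hCi := (integrableOn_dbar_mul hSL hSLb hχ auxL
    ((hpd 0).mono (inter_subset_right.trans hNLΩ))).norm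
  set C := ∫ w in V ∩ NL, ‖dbar χ w * (g w ^ 0 * (w - w₀)⁻¹)‖ with hC
  have hbound : ∀ k : ℕ, 2 * Real.pi ≤ s ^ k * C := by
    intro k
    have h1 : ‖∫ w in V ∩ NL, dbar χ w * (g w ^ k * (w - w₀)⁻¹)‖ = 2 * Real.pi := by
      rw [hmain k]
      simp [abs_of_pos Real.pi_pos]
    rw [← h1, hC, ← integral_const_mul]
    refine norm_integral_le_of_norm_le (hCi.const_mul _) ?_
    rw [ae_restrict_iff' hSL.measurableSet]
    refine .of_forall fun w hw => ?_
    have hgs : ‖g w‖ ≤ s := by simpa using (mem_ball_zero_iff.1 hw.2.1.2).le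
    rw [pow_zero, one_mul]
    calc ‖dbar χ w * (g w ^ k * (w - w₀)⁻¹)‖ = ‖g w‖ ^ k * ‖dbar χ w * (w - w₀)⁻¹‖ := by
          simp only [norm_mul, norm_pow]; ring
      _ ≤ s ^ k * ‖dbar χ w * (w - w₀)⁻¹‖ := by gcongr
  have ht : Tendsto (fun k : ℕ => s ^ k * C) atTop (𝓝 (0 * C)) :=
    (tendsto_pow_atTop_nhds_zero_of_lt_one hs0 hs1).mul_const _
  rw [zero_mul] at ht
  have := ge_of_tendsto' ht hbound
  linarith [Real.pi_pos]

end Conformal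

section Sphere

lemma infty_notMem_toSphere (M : Set ℂ) : OnePoint.infty ∉ toSphere M := by
  rintro ⟨z, -, h⟩
  exact OnePoint.coe_ne_infty z h

lemma coe_mem_toSphere {M : Set ℂ} {z : ℂ} : (z : OnePoint ℂ) ∈ toSphere M ↔ z ∈ M :=
  OnePoint.coe_injective.mem_set_image

lemma subset_toSphere_of_isPreconnected {V X : Set ℂ} (hV : IsOpen V)
    (hVb : Bornology.IsBounded V) (hVX : closure V ⊆ V ∪ X) {S : Set (OnePoint ℂ)}
    (hS : IsPreconnected S) (hSX : Disjoint S (toSphere X)) (hne : (S ∩ toSphere V).Nonempty) :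
    S ⊆ toSphere V := by
  refine IsPreconnected.subset_left_of_subset_union (v := (toSphere (closure V))ᶜ)
    (OnePoint.isOpen_image_coe.2 hV)
    (OnePoint.isOpen_compl_image_coe.2 ⟨isClosed_closure, hVb.isCompact_closure⟩)
    (disjoint_compl_right_iff_subset.2 (image_mono subset_closure)) ?_ hne hS
  intro x hx
  by_cases h : x ∈ toSphere (closure V)
  · obtain ⟨z, hz, rfl⟩ := h
    rcases hVX hz with hz | hz
    · exact .inl (coe_mem_toSphere.2 hz)
    · exact absurd (coe_mem_toSphere.2 hz) (disjoint_left.1 hSX hx)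
  · exact .inr h

/-- The polynomial hull of a compact subset of a set without holes stays in the set. -/
lemma holHull_univ_subset_of_hasNoHoles {K M : Set ℂ} (hK : IsCompact K) (hKM : K ⊆ M)
    (hM : HasNoHoles M) : holHull univ K ⊆ M := by
  intro w hw
  by_contra hwM
  obtain ⟨hVo, hVb, -, hVX⟩ := nonremovable_spec hK (subset_univ K)
  set V := {w | w ∉ K ∧ ¬ PoleRemovable univ K w}
  have hwV : w ∈ V := ⟨fun h => hwM (hKM h), hw⟩
  have hwm : (w : OnePoint ℂ) ∈ (toSphere M)ᶜ := fun h => hwM (coe_mem_toSphere.1 h)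
  refine hM (connectedComponentIn (toSphere M)ᶜ w) ⟨⟨w, hwm, rfl⟩, fun hinf => ?_⟩
  refine infty_notMem_toSphere V (subset_toSphere_of_isPreconnected hVo hVb hVX
    isPreconnected_connectedComponentIn ?_ ⟨w, mem_connectedComponentIn hwm,
      coe_mem_toSphere.2 hwV⟩ hinf)
  exact disjoint_left.2 fun x hx hxK => connectedComponentIn_subset _ _ hx (image_mono hKM hxK)

lemma HasNoHoles.holConvex {K : Set ℂ} (hK : IsCompact K) (h : HasNoHoles K) :
    HolConvex univ K := fun _ hw =>
  not_not.1 fun hn => hw (holHull_univ_subset_of_hasNoHoles hK le_rfl h hn)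

lemma infty_mem_closure_toSphere {H : Set ℂ} (hH : ¬ Bornology.IsBounded H) :
    OnePoint.infty ∈ closure (toSphere H) := by
  by_contra h
  have ho : IsOpen (closure (toSphere H))ᶜ := isClosed_closure.isOpen_compl
  have hc := ((OnePoint.isOpen_iff_of_mem h).1 ho).2
  refine hH (hc.isBounded.subset fun z hz hz' => hz' (subset_closure (coe_mem_toSphere.2 hz)))

lemma HolConvex.hasNoHoles {K : Set ℂ} (hK : IsCompact K) (h : HolConvex univ K) :
    HasNoHoles K := by
  rintro _ ⟨⟨x, hx, rfl⟩, hinf⟩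
  induction x using OnePoint.rec with
  | infty => exact hinf (mem_connectedComponentIn hx)
  | coe w =>
    have hwK : w ∈ Kᶜ := fun h => hx (coe_mem_toSphere.2 h)
    set H := connectedComponentIn Kᶜ w with hH
    have hHo : IsOpen H := hK.isClosed.isOpen_compl.connectedComponentIn
    have hwH : w ∈ H := mem_connectedComponentIn hwK
    by_cases hb : Bornology.IsBounded H
    · obtain ⟨e, he, hl⟩ := h w hwK
      rw [differentiableOn_univ] at he
      have hgd : Differentiable ℂ fun z => 1 - (z - w) * e z := by fun_prop
      obtain ⟨r, hr0, hr1, hr⟩ :=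
        exists_norm_le_of_forall_norm_lt hK hgd.continuous.continuousOn one_pos hl
      have hfr : frontier H ⊆ K := by
        intro y hy
        by_contra hyK
        have ho : IsOpen (connectedComponentIn Kᶜ y) := hK.isClosed.isOpen_compl.connectedComponentIn
        obtain ⟨t, ht1, ht2⟩ := mem_closure_iff.1 (frontier_subset_closure hy) _ ho
          (mem_connectedComponentIn hyK)
        have : y ∈ H := by
          rw [hH, connectedComponentIn_eq ht2, ← connectedComponentIn_eq ht1]
          exact mem_connectedComponentIn hyK
        rw [hHo.frontier_eq] at hy
        exact hy.2 this
      have := Complex.norm_le_of_forall_mem_frontier_norm_le hb hgd.diffContOnCl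
        (fun z hz => hr z (hfr hz)) (subset_closure hwH)
      simp only [sub_self, zero_mul, sub_zero, norm_one] at this
      linarith
    · apply hinf
      have h1 : IsPreconnected (toSphere H) :=
        isPreconnected_connectedComponentIn.image _ OnePoint.continuous_coe.continuousOn
      have h2 : IsPreconnected (insert OnePoint.infty (toSphere H)) :=
        h1.subset_closure (subset_insert _ _)
          (insert_subset (infty_mem_closure_toSphere hb) subset_closure)
      refine h2.subset_connectedComponentIn (.inr (coe_mem_toSphere.2 hwH)) ?_ (.inl rfl)
      refine insert_subset (infty_notMem_toSphere K) ?_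
      rintro _ ⟨z, hz, rfl⟩ hzK
      exact connectedComponentIn_subset _ _ hz (coe_mem_toSphere.1 hzK)

/-- Every compact subset of an open set without holes lies in a compact subset without holes. -/
lemma exists_kZero_superset {M U : Set ℂ} (hU : U ∈ UZero M) {K : Set ℂ} (hK : IsCompact K)
    (hKU : K ⊆ U) : ∃ L ∈ KZero M, K ⊆ L ∧ L ⊆ U := by
  obtain ⟨hUM, -, ⟨p, hp⟩, hUh⟩ := hU
  have hK' : IsCompact (insert p K) := hK.insert p
  have hL := isCompact_holHull hK' (subset_univ _)
  have hLU := holHull_univ_subset_of_hasNoHoles hK' (insert_subset hp hKU) hUh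
  refine ⟨holHull univ (insert p K), ⟨hLU.trans hUM, hL, ⟨p, subset_holHull (mem_insert _ _)⟩,
    (holConvex_holHull isOpen_univ (subset_univ _)).hasNoHoles hL⟩,
    (subset_insert _ _).trans subset_holHull, hLU⟩

lemma sphereBoundary_nonempty {Ω : Set ℂ} (hne : Ω.Nonempty) : (sphereBoundary Ω).Nonempty := by
  obtain ⟨z, hz⟩ := hne
  exact nonempty_frontier_iff.2 ⟨⟨z, coe_mem_toSphere.2 hz⟩,
    fun h => infty_notMem_toSphere Ω (h ▸ mem_univ _)⟩

lemma coe_mem_sphereBoundary {Ω : Set ℂ} (hΩ : IsOpen Ω) {z : ℂ}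
    (hz : (z : OnePoint ℂ) ∈ sphereBoundary Ω) : z ∉ Ω := by
  intro h
  have ho : IsOpen (toSphere Ω) := OnePoint.isOpen_image_coe.2 hΩ
  rw [sphereBoundary, ho.frontier_eq] at hz
  exact hz.2 (coe_mem_toSphere.2 h)

lemma sqrt_one_add_sq_le {x : ℝ} (hx : 0 ≤ x) : √(1 + x ^ 2) ≤ 1 + x := by
  rw [Real.sqrt_le_left (by positivity)]
  nlinarith

/-- Compact subsets of `Ω` have positive chordal distance to the boundary of `Ω`. -/
lemma exists_le_chordalInfDist {Ω L : Set ℂ} (hΩ : IsOpen Ω) (hne : Ω.Nonempty) (hL : IsCompact L)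
    (hLΩ : L ⊆ Ω) :
    ∃ δ > 0, ∀ w ∈ L, δ ≤ chordalInfDist (OnePoint.some w) (sphereBoundary Ω) := by
  obtain ⟨R, hR0, hR⟩ : ∃ R, 0 < R ∧ ∀ w ∈ L, ‖w‖ ≤ R := hL.isBounded.exists_pos_norm_le
  obtain ⟨d, hd, hdL⟩ := hL.exists_thickening_subset_open hΩ hLΩ
  have hdz : ∀ w ∈ L, ∀ z ∉ Ω, d ≤ ‖w - z‖ := by
    intro w hw z hz
    by_contra h
    refine hz (hdL (Metric.mem_thickening_iff.2 ⟨w, hw, ?_⟩))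
    rw [dist_comm, dist_eq_norm]
    exact not_le.1 h
  refine ⟨min (2 / (1 + R)) (2 * d / ((1 + R) * (1 + R + d))), by positivity, fun w hw => ?_⟩
  refine le_csInf ((sphereBoundary_nonempty hne).image _) ?_
  rintro _ ⟨b, hb, rfl⟩
  have hs1 : √(1 + ‖w‖ ^ 2) ≤ 1 + R :=
    (sqrt_one_add_sq_le (norm_nonneg w)).trans (by linarith [hR w hw])
  have hp : ∀ z : ℂ, 0 < √(1 + ‖z‖ ^ 2) := fun z => Real.sqrt_pos.2 (by positivity)
  induction b using OnePoint.rec with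
  | infty =>
    refine (min_le_left _ _).trans ?_
    change 2 / (1 + R) ≤ 2 / √(1 + ‖w‖ ^ 2)
    have := hp w
    gcongr
  | coe z =>
    refine (min_le_right _ _).trans ?_
    change _ ≤ 2 * ‖w - z‖ / (√(1 + ‖w‖ ^ 2) * √(1 + ‖z‖ ^ 2))
    have hdw := hdz w hw z (coe_mem_sphereBoundary hΩ hb)
    have hz : ‖z‖ ≤ R + ‖w - z‖ := by
      have := norm_sub_norm_le z w
      rw [norm_sub_rev] at this
      linarith [hR w hw]
    have hs2 : √(1 + ‖z‖ ^ 2) ≤ 1 + R + ‖w - z‖ :=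
      (sqrt_one_add_sq_le (norm_nonneg z)).trans (by linarith)
    calc 2 * d / ((1 + R) * (1 + R + d)) ≤ 2 * ‖w - z‖ / ((1 + R) * (1 + R + ‖w - z‖)) := by
          rw [div_le_div_iff₀ (by positivity) (by positivity)]
          have : 0 ≤ (‖w - z‖ - d) * (1 + R) * (1 + R) := by
            have : 0 ≤ ‖w - z‖ - d := by linarith
            positivity
          nlinarith
      _ ≤ _ := by
          have h1 := hp w
          have h2 := hp z
          gcongr

end Sphere

section Universality

lemma exists_compact_subset_of_mem_nhds {M : Set ℂ} {h : C(M, ℂ)} {W : Set C(M, ℂ)}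
    (hW : W ∈ 𝓝 h) : ∃ K ⊆ M, IsCompact K ∧ ∃ ε > 0, ∀ g : C(M, ℂ),
      (∀ z : M, (z : ℂ) ∈ K → ‖g z - h z‖ < ε) → g ∈ W := by
  obtain ⟨⟨K, ε⟩, ⟨hK, hε⟩, hKW⟩ := (nhds_basis_uniformity
    (Metric.uniformity_basis_dist.compactConvergenceUniformity (α := M) (β := ℂ))).mem_iff.1 hW
  refine ⟨Subtype.val '' K, by rintro _ ⟨z, -, rfl⟩; exact z.2,
    hK.image continuous_subtype_val, ε, hε, fun g hg => hKW fun z hz => ?_⟩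
  have := hg z (mem_image_of_mem _ hz)
  rwa [← dist_eq_norm] at this

/-- A function holomorphic on `U` as an element of `H(U)`. -/
def Hol.mk {U : Set ℂ} (e : ℂ → ℂ) (he : DifferentiableOn ℂ e U) : Hol U :=
  ⟨⟨fun z => e z, continuousOn_iff_continuous_domRestrict.1 he.continuousOn⟩, e, he, fun _ => rfl⟩

lemma isClosed_hol {U : Set ℂ} (hU : IsOpen U) : IsClosed (Hol U) := by
  have : LocallyCompactSpace U := hU.locallyCompactSpace
  set E : C(U, ℂ) → ℂ → ℂ := fun g => Function.extend Subtype.val g 0 with hE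
  have hEa : ∀ g (z : U), E g z = g z := fun g z => Subtype.val_injective.extend_apply _ _ _
  rw [isClosed_iff_forall_filter]
  intro x F hF hFU hFx
  refine ⟨E x, ?_, fun z => (hEa x z).symm⟩
  refine TendstoLocallyUniformlyOn.differentiableOn (φ := F) (F := E) ?_ ?_ hU
  · rw [tendstoLocallyUniformlyOn_iff_tendstoLocallyUniformly_comp_coe]
    have h1 := ContinuousMap.tendsto_iff_tendstoLocallyUniformly.1
      (hFx : Tendsto (fun g : C(U, ℂ) => g) F (𝓝 x))
    convert h1 using 1
    · ext g z; exact hEa g z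
    · ext z; exact hEa x z
  · filter_upwards [le_principal_iff.1 hFU] with g hg
    obtain ⟨G, hG, hgG⟩ := hg
    exact hG.congr fun z hz => (hEa g ⟨z, hz⟩).trans (hgG ⟨z, hz⟩)

lemma baireSpace_hol {U : Set ℂ} (hU : IsOpen U) : BaireSpace (Hol U) := by
  have : LocallyCompactSpace U := hU.locallyCompactSpace
  have : CompleteSpace (Hol U) := (isClosed_hol hU).completeSpace_coe
  let := UniformSpace.pseudoMetricSpace (Hol U)
  infer_instance

lemma differentiableOn_iterate {D : Set ℂ} {f : ℂ → ℂ} (hf : DifferentiableOn ℂ f D)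
    (hfD : MapsTo f D D) (n : ℕ) : DifferentiableOn ℂ f^[n] D := by
  induction n with
  | zero => exact differentiableOn_id
  | succ n ih =>
    rw [Function.iterate_succ']
    exact hf.comp ih (hfD.iterate n)

/-- Simultaneous approximation on a compact subset of `Ω` and along an iterate of `f`. -/
theorem exists_approx_and_comp_iterate_approx {D Ω : Set ℂ} {f : ℂ → ℂ} (hΩ : IsOpen Ω)
    (hDΩ : D ⊆ Ω) (hf : DifferentiableOn ℂ f D) (hfD : MapsTo f D D) {U : Set ℂ}
    (hU : U ∈ UZeroDyn D Ω f) {K L : Set ℂ} (hK : IsCompact K) (hKU : K ⊆ U) (hL : IsCompact L)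
    (hLΩ : L ⊆ Ω) {h g : ℂ → ℂ} (hh : DifferentiableOn ℂ h U) (hg : DifferentiableOn ℂ g Ω)
    {ε : ℝ} (hε : 0 < ε) :
    ∃ e : ℂ → ℂ, DifferentiableOn ℂ e Ω ∧ (∀ z ∈ L, ‖e z - g z‖ < ε) ∧
      ∃ n, 1 ≤ n ∧ ∀ z ∈ K, ‖e (f^[n] z) - h z‖ < ε := by
  obtain ⟨hU0, hdist, hinj⟩ := hU
  obtain ⟨K', ⟨hK'D, hK', -, hK'h⟩, hKK', hK'U⟩ := exists_kZero_superset hU0 hK hKU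
  obtain ⟨hUD, hUo, ⟨p, hp⟩, -⟩ := hU0
  have hL' := isCompact_holHull hL hLΩ
  have hL'Ω := holHull_subset hLΩ
  set L' := holHull Ω L
  obtain ⟨δ, hδ, hδL⟩ := exists_le_chordalInfDist hΩ ⟨p, hDΩ (hUD hp)⟩ hL' hL'Ω
  have hev := Metric.tendstoUniformlyOn_iff.1
    ((tendstoLocallyUniformlyOn_iff_forall_isCompact hUo).1 hdist K' hK'U hK') δ hδ
  obtain ⟨n, hn, hn1⟩ := (hev.and (eventually_ge_atTop 1)).exists
  set φ := f^[n] with hφdef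
  have hφ : DifferentiableOn ℂ φ U := (differentiableOn_iterate hf hfD n).mono hUD
  have hφi : InjOn φ U := hinj n
  have hφΩ : φ '' K' ⊆ Ω := by
    rintro _ ⟨z, hz, rfl⟩
    exact hDΩ (hfD.iterate n (hK'D hz))
  have hdisj : Disjoint L' (φ '' K') := by
    rw [disjoint_left]
    rintro _ hz ⟨y, hy, rfl⟩
    have h1 := hn y hy
    rw [dist_comm, Real.dist_0_eq_abs] at h1
    linarith [hδL _ hz, le_abs_self (chordalInfDist (OnePoint.some (φ y)) (sphereBoundary Ω))]
  have hφK' : IsCompact (φ '' K') := hK'.image_of_continuousOn (hφ.continuousOn.mono hK'U)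
  have hc : HolConvex Ω (L' ∪ φ '' K') := HolConvex.union_image hΩ hL' hL'Ω
    (holConvex_holHull hΩ hLΩ) hK' (hK'h.holConvex hK') hUo hK'U hφ hφi hφΩ hdisj
  obtain ⟨W₁, W₂, hW₁, hW₂, hLW, hKW, hWd⟩ := SeparatedNhds.of_isCompact_isCompact hL' hφK' hdisj
  have hφU := isOpen_image_of_injOn hUo hφ hφi hUo le_rfl
  classical
  set H : ℂ → ℂ := fun z => if z ∈ W₂ then h (Function.invFunOn φ U z) else g z with hH
  have hHd : DifferentiableOn ℂ H ((W₁ ∩ Ω) ∪ (W₂ ∩ φ '' U)) := by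
    rintro z (⟨hz, hzΩ⟩ | ⟨hz, hzU⟩)
    · refine DifferentiableAt.differentiableWithinAt
        ((hg.differentiableAt (hΩ.mem_nhds hzΩ)).congr_of_eventuallyEq ?_)
      filter_upwards [hW₁.mem_nhds hz] with y hy
      exact if_neg (disjoint_left.1 hWd hy)
    · refine DifferentiableAt.differentiableWithinAt
        (((hh.comp (differentiableOn_invFunOn hUo hφ hφi) fun w hw =>
          Function.invFunOn_mem hw).differentiableAt (hφU.mem_nhds hzU)).congr_of_eventuallyEq ?_)
      filter_upwards [hW₂.mem_nhds hz] with y hy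
      exact if_pos hy
  obtain ⟨e, he, hl⟩ := hc.runge (hL'.union hφK') (union_subset hL'Ω hφΩ)
    ((hW₁.inter hΩ).union (hW₂.inter hφU))
    (union_subset_union (subset_inter hLW hL'Ω) (subset_inter hKW (image_mono hK'U))) hHd hε
  refine ⟨e, he, fun z hz => ?_, n, hn1, fun z hz => ?_⟩
  · have hzL : z ∈ L' := subset_holHull hz
    have := hl z (.inl hzL)
    simp only [hH] at this
    rwa [if_neg (disjoint_left.1 hWd (hLW hzL))] at this
  · have hzK : φ z ∈ φ '' K' := mem_image_of_mem φ (hKK' hz)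
    have := hl (φ z) (.inr hzK)
    simp only [hH] at this
    rwa [if_pos (hKW hzK), hφi.leftInvOn_invFunOn (hKU hz)] at this

lemma compOrbit_eq_range {D Ω U : Set ℂ} {f : ℂ → ℂ} (hDΩ : D ⊆ Ω)
    (hf : DifferentiableOn ℂ f D) (hfD : MapsTo f D D) (hUD : U ⊆ D) :
    ∃ c : ℕ → C(U, Ω), (∀ n z, (c n z : ℂ) = f^[n] z) ∧
      ∀ g : C(Ω, ℂ), compOrbit f U g = {a | ∃ n, 1 ≤ n ∧ a = g.comp (c n)} := by
  have hm : ∀ n (z : U), f^[n] z ∈ Ω := fun n z => hDΩ (hfD.iterate n (hUD z.2))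
  refine ⟨fun n => ⟨fun z => ⟨f^[n] z, hm n z⟩, Continuous.subtype_mk
    (continuousOn_iff_continuous_domRestrict.1
      ((differentiableOn_iterate hf hfD n).continuousOn.mono hUD)) _⟩, fun n z => rfl, fun g => ?_⟩
  ext a
  constructor
  · rintro ⟨n, hn, ha⟩
    refine ⟨n, hn, ?_⟩
    ext z
    obtain ⟨_, h⟩ := ha z
    exact h
  · rintro ⟨n, hn, rfl⟩
    exact ⟨n, hn, fun z => ⟨hm n z, rfl⟩⟩

lemma isOpen_setOf_compOrbit_meets {D Ω U : Set ℂ} {f : ℂ → ℂ} (hDΩ : D ⊆ Ω)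
    (hf : DifferentiableOn ℂ f D) (hfD : MapsTo f D D) (hUD : U ⊆ D) {W : Set C(U, ℂ)}
    (hW : IsOpen W) : IsOpen {g : Hol Ω | (W ∩ compOrbit f U g.1).Nonempty} := by
  obtain ⟨c, -, hc⟩ := compOrbit_eq_range hDΩ hf hfD hUD
  have : {g : Hol Ω | (W ∩ compOrbit f U g.1).Nonempty} =
      ⋃ n : ℕ, ⋃ _ : 1 ≤ n, (fun g : Hol Ω => g.1.comp (c n)) ⁻¹' W := by
    ext g
    simp only [mem_ofPred_eq, hc, mem_iUnion, mem_preimage]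
    constructor
    · rintro ⟨a, haW, n, hn, rfl⟩
      exact ⟨n, hn, haW⟩
    · rintro ⟨n, hn, h⟩
      exact ⟨_, h, n, hn, rfl⟩
  rw [this]
  exact isOpen_iUnion fun n => isOpen_iUnion fun _ =>
    hW.preimage ((ContinuousMap.continuous_precomp (c n)).comp continuous_subtype_val)

lemma dense_setOf_compOrbit_meets {D Ω : Set ℂ} {f : ℂ → ℂ} (hΩ : IsOpen Ω)
    (hDΩ : D ⊆ Ω) (hf : DifferentiableOn ℂ f D) (hfD : MapsTo f D D) {U : Set ℂ}
    (hU : U ∈ UZeroDyn D Ω f) {W : Set C(U, ℂ)} (hW : IsOpen W) (hne : (W ∩ Hol U).Nonempty) :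
    Dense {g : Hol Ω | (W ∩ compOrbit f U g.1).Nonempty} := by
  obtain ⟨h, hhW, h', hh', hhh'⟩ := hne
  obtain ⟨K, hKU, hK, ε, hε, hKW⟩ := exists_compact_subset_of_mem_nhds (hW.mem_nhds hhW)
  obtain ⟨c, hca, hc⟩ := compOrbit_eq_range hDΩ hf hfD hU.1.1
  intro g
  rw [mem_closure_iff_nhds]
  intro O hO
  obtain ⟨O', hO', hOO⟩ := mem_nhds_subtype _ _ _ |>.1 hO
  obtain ⟨L, hLΩ, hL, η, hη, hLO⟩ := exists_compact_subset_of_mem_nhds hO'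
  obtain ⟨G, hG, hgG⟩ := g.2
  obtain ⟨e, he, heL, n, hn, heK⟩ := exists_approx_and_comp_iterate_approx hΩ hDΩ hf hfD hU hK hKU
    hL hLΩ hh' hG (lt_min hε hη)
  refine ⟨Hol.mk e he, hOO (hLO _ fun z hz => ?_), ?_⟩
  · rw [hgG]
    exact (heL z hz).trans_le (min_le_right _ _)
  · refine ⟨(Hol.mk e he).1.comp (c n), hKW _ fun z hz => ?_, ?_⟩
    · rw [hhh']
      have := (heK z hz).trans_le (min_le_left _ _)
      rwa [← hca] at this
    · rw [hc]
      exact ⟨n, hn, rfl⟩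

/-- Universality on an exhausting sequence implies universality on all open sets without holes. -/
lemma isUniversal_of_exhausting {D Ω : Set ℂ} {f : ℂ → ℂ} (hDΩ : D ⊆ Ω)
    (hf : DifferentiableOn ℂ f D) (hfD : MapsTo f D D) {M : ℕ → Set ℂ}
    (hM : IsKZeroExhausting D M) {g : Hol Ω} (hg : ∀ n, IsUniversal f (M n) (Hol (M n)) g)
    {U : Set ℂ} (hU : U ∈ UZero D) : IsUniversal f U (Hol U) g := by
  rintro h ⟨h', hh', hhh'⟩
  rw [mem_closure_iff_nhds]
  intro O hO
  obtain ⟨K, hKU, hK, ε, hε, hKO⟩ := exists_compact_subset_of_mem_nhds hO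
  obtain ⟨L, hL, hKL, hLU⟩ := exists_kZero_superset hU hK hKU
  obtain ⟨N, hN⟩ := hM.2 L hL
  have hLM : L ⊆ M N := hN.trans interior_subset
  obtain ⟨e, he, hel⟩ := (hL.2.2.2.holConvex hL.2.1).runge hL.2.1 (subset_univ L) hU.2.1 hLU hh'
    (half_pos hε)
  have hcl := hg N (Hol.mk e (he.mono (subset_univ _))).2
  obtain ⟨c, hca, hc⟩ := compOrbit_eq_range hDΩ hf hfD (hM.1 N)
  obtain ⟨c', hca', hc'⟩ := compOrbit_eq_range hDΩ hf hfD hU.1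
  rw [hc, mem_closure_iff_nhds] at hcl
  have hLc : IsCompact (Subtype.val ⁻¹' L : Set (M N)) :=
    Topology.IsInducing.subtypeVal.isCompact_preimage' hL.2.1 (by simpa using hLM)
  have hO' : {a : C(M N, ℂ) | ∀ z : M N, (z : ℂ) ∈ L → ‖a z - e z‖ < ε / 2} ∈
      𝓝 (Hol.mk e (he.mono (subset_univ (M N)))).1 := by
    refine (nhds_basis_uniformity (Metric.uniformity_basis_dist.compactConvergenceUniformity
      (α := M N) (β := ℂ))).mem_iff.2 ⟨⟨_, ε / 2⟩, ⟨hLc, half_pos hε⟩, fun a ha z hz => ?_⟩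
    rw [← dist_eq_norm]
    exact ha z hz
  obtain ⟨_, ha, n, hn, rfl⟩ := hcl _ hO'
  refine ⟨g.1.comp (c' n), hKO _ fun z hz => ?_, ?_⟩
  · have h1 := ha ⟨z, hLM (hKL hz)⟩ (hKL hz)
    have h2 := hel z (hKL hz)
    have h3 : c' n z = c n ⟨z, hLM (hKL hz)⟩ := Subtype.ext (by rw [hca, hca'])
    rw [hhh', ContinuousMap.comp_apply, h3]
    calc _ = ‖(g.1 (c n ⟨z, hLM (hKL hz)⟩) - e z) + (e z - h' z)‖ := by rw [sub_add_sub_cancel]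
      _ ≤ _ := norm_add_le _ _
      _ < ε / 2 + ε / 2 := add_lt_add h1 h2
      _ = ε := add_halves ε
  · rw [hc']
    exact ⟨n, hn, rfl⟩

end Universality

end CompUniv

theorem mainTheorem2 (D Ω : Set ℂ) (f : ℂ → ℂ)
    (hD : IsOpen D) (hΩ : IsOpen Ω) (hΩc : IsConnected Ω) (hDΩ : D ⊆ Ω)
    (hf : DifferentiableOn ℂ f D) (hfD : MapsTo f D D)
    (hex : ∃ M : ℕ → Set ℂ, IsKZeroExhausting D M ∧ ∀ n, M n ∈ UZeroDyn D Ω f) :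
    IsComeager {g : Hol Ω | ∀ U ∈ UZero D, IsUniversal f U (Hol U) g} := by
  obtain ⟨M, hM, hMU⟩ := hex
  have := baireSpace_hol hΩ
  have hloc : ∀ n, LocallyCompactSpace (M n) := fun n => (hMU n).1.2.1.locallyCompactSpace
  set B : ∀ n, Set (Set C(M n, ℂ)) := fun n =>
    {W ∈ TopologicalSpace.countableBasis C(M n, ℂ) | (W ∩ Hol (M n)).Nonempty}
  have hB : ∀ n, (B n).Countable := fun n =>
    (TopologicalSpace.countable_countableBasis _).mono (sep_subset _ _)
  have hBo : ∀ n, ∀ W ∈ B n, IsOpen W := fun n W hW =>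
    TopologicalSpace.isOpen_of_mem_countableBasis hW.1
  have ho : ∀ n, ∀ W ∈ B n, IsOpen {g : Hol Ω | (W ∩ compOrbit f (M n) g.1).Nonempty} :=
    fun n W hW => isOpen_setOf_compOrbit_meets hDΩ hf hfD (hM.1 n) (hBo n W hW)
  refine ⟨⋂ n, ⋂ W ∈ B n, {g : Hol Ω | (W ∩ compOrbit f (M n) g.1).Nonempty}, ?_, ?_, ?_⟩
  · intro g hg U hU
    refine isUniversal_of_exhausting hDΩ hf hfD hM (fun n h hh => ?_) hU
    rw [(TopologicalSpace.isBasis_countableBasis C(M n, ℂ)).mem_closure_iff]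
    intro W hW hhW
    exact mem_iInter₂.1 (mem_iInter.1 hg n) W ⟨hW, h, hhW, hh⟩
  · exact .iInter fun n => .biInter (hB n) fun W hW => (ho n W hW).isGδ
  · refine dense_iInter_of_Gδ (fun n => .biInter (hB n) fun W hW => (ho n W hW).isGδ) fun n => ?_
    exact dense_biInter_of_isOpen (ho n) (hB n) fun W hW =>
      dense_setOf_compOrbit_meets hΩ hDΩ hf hfD (hMU n) (hBo n W hW) hW.2
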